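/- Let $G=(G(x))_{x\in\mathbb R}$ be a centered stationary Gaussian random field on $\mathbb R$ with almost surely continuous realizations and covariance $\mathbb E[G(x)G(y)]=\mathcal C(x-y)$, and assume that for some $\beta>1$ and some constant $A$ we have $|\mathcal C(x)|\le A(1+|x|)^{-\beta}$ for all $x\in\mathbb R$. Assume that $G\not\equiv 0$ (that is, $G$ does not vanish identically almost surely), and set $a(x):=\exp(G(x))$. Then almost surely, for all $\varepsilon>0$ and $f\in C^1([0,1])$, the problem $$\big(a(\tfrac x\varepsilon)u_\varepsilon'(x)\big)'=f'(x)\ \text{ on }(0,1),\qquad u_\varepsilon(0)=u_\varepsilon(1)=0,$$ has a unique solution $u_\varepsilon\in C^1([0,1])$. The functions $x\mapsto \mathrm{Cov}(\frac1{a(x)},\frac1{a(0)})$ and $x\mapsto e^{\mathcal C(x)}-1$ are integrable on $\mathbb R$, and $$\mathcal Q:=\int_{\mathbb R}\mathrm{Cov}\Big(\frac1{a(x)},\frac1{a(0)}\Big)dx=e^{\mathcal C(0)}\int_{\mathbb R}\big(e^{\mathcal C(x)}-1\big)dx>0 .$$ Moreover there is a constant $K$ (depending on the field $G$ and on $\beta$,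 but not on $f,g,\varepsilon$) such that the following holds for all $f,g\in C^1([0,1])$ and all $\varepsilon>0$. Let $u_\varepsilon$ be the solution of the above problem, let $v_\varepsilon$ be the solution with $f$ replaced by $g$, and set $$I_\varepsilon(f,g):=\int_0^1u_\varepsilon'(x)g(x)\,dx,\qquad \sigma_\varepsilon(f,g):=\sqrt{\varepsilon^{-1}\mathrm{Var}\, I_\varepsilon(f,g)} .$$ Then almost surely $I_\varepsilon(f,g)=\int_0^1v_\varepsilon'(x)f(x)\,dx$, the random variable $I_\varepsilon(f,g)$ is square integrable, and $$\big|\sigma_\varepsilon(f,g)^2-\sigma(f,g)^2\big|\le K\,\|f\|_{C^1([0,1])}^2\,\|g\|_{C^1([0,1])}^2\;\varepsilon^{\min\{\frac12,\beta-1\}},$$ where $$\sigma(f,g)^2:=\mathcal Q\int_0^1\Big(f-\int_0^1f\Big)^2\Big(g-\int_0^1g\Big)^2,\qquad \|f\|_{C^1([0,1])}:=\sup_{[0,1]}|f|+\sup_{[0,1]}|f'| .$$ -/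

import Mathlib

open MeasureTheory ProbabilityTheory Set

namespace LogNormalHomogenization

noncomputable section

/-- `G` is a centered Gaussian random field on `ℝ` (all finite-dimensional marginals are Gaussian)
with covariance `E[G(x)G(y)] = C(x - y)`. For a centered Gaussian field, depending on `x - y` only
is stationarity. -/
structure IsStationaryGaussianField {Ω : Type*} [MeasurableSpace Ω] (P : Measure Ω)
    (G : ℝ → Ω → ℝ) (C : ℝ → ℝ) : Prop where
  gaussian : IsGaussianProcess G P
  mean_zero : ∀ x, P[G x] = 0
  cov_eq : ∀ x y, cov[G x, G y; P] = C (x - y)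

/-- The log-normal coefficient field `a(x) = exp(G(x))`. -/
def coeff {Ω : Type*} (G : ℝ → Ω → ℝ) (x : ℝ) (ω : Ω) : ℝ := Real.exp (G x ω)

/-- `u ∈ C¹([0,1])` solves `(a(x/ε) u'(x))' = f'(x)` on `(0,1)`, `u(0) = u(1) = 0`, for one
realization `a : ℝ → ℝ` of the coefficient. -/
structure IsSolution (a : ℝ → ℝ) (ε : ℝ) (f u : ℝ → ℝ) : Prop where
  contDiffOn : ContDiffOn ℝ 1 u (Icc 0 1)
  equation : ∀ x ∈ Ioo (0 : ℝ) 1,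
    HasDerivAt (fun y => a (y / ε) * derivWithin u (Icc 0 1) y) (derivWithin f (Icc 0 1) x) x
  left : u 0 = 0
  right : u 1 = 0

/-- The observable `∫₀¹ u'(x) g(x) dx`. -/
def observable (u g : ℝ → ℝ) : ℝ := ∫ x in (0 : ℝ)..1, derivWithin u (Icc 0 1) x * g x

/-- `σ_ε = sqrt (ε⁻¹ Var I)` for a random variable `I`. -/
def sigmaEps {Ω : Type*} [MeasurableSpace Ω] (P : Measure Ω) (ε : ℝ) (I : Ω → ℝ) : ℝ :=
  Real.sqrt (ε⁻¹ * Var[I; P])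

/-- The covariance `c(x) = Cov(1/a(x), 1/a(0))`. -/
def covInv {Ω : Type*} [MeasurableSpace Ω] (P : Measure Ω) (G : ℝ → Ω → ℝ) (x : ℝ) : ℝ :=
  cov[fun ω => 1 / coeff G x ω, fun ω => 1 / coeff G 0 ω; P]

/-- `𝒬 = ∫_ℝ Cov(1/a(x), 1/a(0)) dx`. -/
def limQ {Ω : Type*} [MeasurableSpace Ω] (P : Measure Ω) (G : ℝ → Ω → ℝ) : ℝ :=
  ∫ x, covInv P G x

/-- The limiting variance `σ²(f,g) = 𝒬 ∫₀¹ (f - ∫₀¹ f)² (g - ∫₀¹ g)²`. -/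
def sigmaSq {Ω : Type*} [MeasurableSpace Ω] (P : Measure Ω) (G : ℝ → Ω → ℝ) (f g : ℝ → ℝ) : ℝ :=
  limQ P G * ∫ x in (0 : ℝ)..1,
    (f x - ∫ y in (0 : ℝ)..1, f y) ^ 2 * (g x - ∫ y in (0 : ℝ)..1, g y) ^ 2

/-- The norm of `C¹([0,1])`: `sup |f| + sup |f'|`. -/
def normC1 (f : ℝ → ℝ) : ℝ :=
  (⨆ x : Icc (0 : ℝ) 1, |f x|) + ⨆ x : Icc (0 : ℝ) 1, |derivWithin f (Icc 0 1) x|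

end

end LogNormalHomogenization

open LogNormalHomogenization

/-! In one dimension the problem is solved explicitly. With `b = 1/a(·/ε)`, the flux minus `f` is
constant, the boundary values fix the constant, and the observable becomes `∫ b f g - (∫ b f)(∫ b g)
/ ∫ b`. This is symmetric in `f` and `g` and, being a covariance for the weight `b`, does not change
when constants are subtracted, so both functions may be centered.

Let `m = exp (C 0 / 2)` be the mean of `b`, and let `X(h)` be the integral of `(b - m) h` over the
unit interval. For centered `f`, `g` the observable is a deterministic term plus `X(f g) - X(f) X(g)
/ ∫ b` (`IsSolution.observable_eq_fluctIntegral`). The variance of the linear term is a double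
integral of a kernel of width `ε`, which concentrates on the diagonal and gives `ε 𝒬 ∫ (f g)²` up to
`O(ε ^ b)`, where from here on `b = min β (3/2)` is an exponent (`exists_kernel_concentration`).

The quadratic term has variance `O(ε²)`. Log-normal moments are explicit, and the four-point
function of `b - m` is a sum of products with at least two decaying correlations, each worth a
factor `ε` after integration (`abs_fourPoint_le`, `integral_pairings_le`). The random denominator
needs no negative moments (`sq_mul_div_le`). The cross term is then `O(ε ^ (3/2))` by
Cauchy–Schwarz, which is the origin of the `1/2` in the rate.

Positivity of `𝒬` follows from `exp t - 1 ≥ t`, strict for `t ≠ 0`, together with `∫ C ≥ 0`, which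
holds because `∫ C` is a limit of rescaled variances of averages of `G`. -/

namespace LogNormalHomogenization

/-! ### The deterministic boundary value problem and its explicit solution. -/

section BoundaryValueProblem

lemma integral_derivWithin_Icc {u : ℝ → ℝ} (hu : ContDiffOn ℝ 1 u (Icc 0 1)) {x : ℝ}
    (hx : x ∈ Icc (0 : ℝ) 1) :
    ∫ t in (0 : ℝ)..x, derivWithin u (Icc 0 1) t = u x - u 0 := by
  have hsub : Icc 0 x ⊆ Icc (0 : ℝ) 1 := Icc_subset_Icc le_rfl hx.2
  have hcont : ContinuousOn (derivWithin u (Icc 0 1)) (Icc 0 1) :=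
    hu.continuousOn_derivWithin (uniqueDiffOn_Icc zero_lt_one) le_rfl
  refine intervalIntegral.integral_eq_sub_of_hasDerivAt_of_le hx.1 (hu.continuousOn.mono hsub)
    (fun t ht => ?_) ((hcont.mono hsub).intervalIntegrable_of_Icc hx.1)
  have htI : t ∈ Ioo (0 : ℝ) 1 := ⟨ht.1, ht.2.trans_le hx.2⟩
  exact ((hu.differentiableOn one_ne_zero t (Ioo_subset_Icc_self htI)).hasDerivWithinAt).hasDerivAt
    (Icc_mem_nhds htI.1 htI.2)

lemma integral_mul_sub_const {b f : ℝ → ℝ} (hb : ContinuousOn b (Icc 0 1))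
    (hf : ContinuousOn f (Icc 0 1)) (p : ℝ) :
    ∫ x in (0 : ℝ)..1, b x * (f x - p) =
      (∫ x in (0 : ℝ)..1, b x * f x) - p * ∫ x in (0 : ℝ)..1, b x := by
  rw [← intervalIntegral.integral_const_mul, ← intervalIntegral.integral_sub
    (ContinuousOn.intervalIntegrable_of_Icc zero_le_one (by fun_prop))
    (ContinuousOn.intervalIntegrable_of_Icc zero_le_one (by fun_prop))]
  exact intervalIntegral.integral_congr fun x _ => by ring

variable {a : ℝ → ℝ} {ε : ℝ} {f g u v : ℝ → ℝ}

lemma continuous_inv_comp_div (ha : Continuous a) (hpos : ∀ x, 0 < a x) :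
    Continuous fun x => (a (x / ε))⁻¹ :=
  (ha.comp (continuous_id.div_const ε)).inv₀ fun x => (hpos (x / ε)).ne'

lemma integral_inv_pos (ha : Continuous a) (hpos : ∀ x, 0 < a x) :
    0 < ∫ x in (0 : ℝ)..1, (a (x / ε))⁻¹ :=
  intervalIntegral.intervalIntegral_pos_of_pos
    ((continuous_inv_comp_div ha hpos).intervalIntegrable _ _)
    (fun x => inv_pos.2 (hpos (x / ε))) zero_lt_one

/-- The flux `a u'` and `f` have the same derivative inside the interval, so by the mean value
theorem and continuity up to the boundary they differ by a constant. -/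
lemma IsSolution.exists_flux_const (ha : Continuous a) (hpos : ∀ x, 0 < a x)
    (hf : ContDiffOn ℝ 1 f (Icc 0 1)) (hu : IsSolution a ε f u) :
    ∃ c, ∀ x ∈ Icc (0 : ℝ) 1,
      derivWithin u (Icc 0 1) x = (a (x / ε))⁻¹ * (f x - c) := by
  have hcu : ContinuousOn (derivWithin u (Icc 0 1)) (Icc 0 1) :=
    hu.contDiffOn.continuousOn_derivWithin (uniqueDiffOn_Icc zero_lt_one) le_rfl
  set ψ : ℝ → ℝ := fun y => a (y / ε) * derivWithin u (Icc 0 1) y - f y with hψ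
  have hψc : ContinuousOn ψ (Icc 0 1) :=
    ((ha.comp (continuous_id.div_const ε)).continuousOn.mul hcu).sub hf.continuousOn
  have hψd : ∀ x ∈ Ioo (0 : ℝ) 1, HasDerivAt ψ 0 x := by
    intro x hx
    have h1 := ((hf.differentiableOn one_ne_zero x
      (Ioo_subset_Icc_self hx)).hasDerivWithinAt).hasDerivAt (Icc_mem_nhds hx.1 hx.2)
    have h2 := (hu.equation x hx).sub h1
    rwa [sub_self] at h2
  have hconst : ∀ x ∈ Icc (0 : ℝ) 1, ψ x = ψ 0 := by
    intro x hx
    rcases hx.1.eq_or_lt with h0 | h0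
    · rw [← h0]
    obtain ⟨y, -, hy⟩ := exists_hasDerivAt_eq_slope ψ (fun _ => 0) h0
      (hψc.mono (Icc_subset_Icc le_rfl hx.2)) fun y hy => hψd y ⟨hy.1, hy.2.trans_le hx.2⟩
    rw [eq_div_iff (by linarith), zero_mul] at hy
    linarith
  refine ⟨-ψ 0, fun x hx => ?_⟩
  have := hconst x hx
  have hne := (hpos (x / ε)).ne'
  rw [eq_inv_mul_iff_mul_eq₀ hne]
  simp only [hψ] at this ⊢
  linarith

/-- The boundary values give `∫ u' = 0`, which determines the flux constant. -/
lemma IsSolution.derivWithin_eq (ha : Continuous a) (hpos : ∀ x, 0 < a x)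
    (hf : ContDiffOn ℝ 1 f (Icc 0 1)) (hu : IsSolution a ε f u) :
    ∀ x ∈ Icc (0 : ℝ) 1, derivWithin u (Icc 0 1) x = (a (x / ε))⁻¹ *
      (f x - (∫ y in (0 : ℝ)..1, (a (y / ε))⁻¹ * f y) / ∫ y in (0 : ℝ)..1, (a (y / ε))⁻¹) := by
  obtain ⟨c, hc⟩ := hu.exists_flux_const ha hpos hf
  have hb := continuous_inv_comp_div (ε := ε) ha hpos
  have hint := integral_derivWithin_Icc hu.contDiffOn (right_mem_Icc.2 zero_le_one)
  rw [hu.left, hu.right, sub_zero, intervalIntegral.integral_congr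
    (g := fun x => (a (x / ε))⁻¹ * (f x - c))
    (fun x hx => hc x (by rwa [uIcc_of_le zero_le_one] at hx)),
    integral_mul_sub_const hb.continuousOn hf.continuousOn] at hint
  have hne := (integral_inv_pos (ε := ε) ha hpos).ne'
  have hceq : c = (∫ y in (0 : ℝ)..1, (a (y / ε))⁻¹ * f y) / ∫ y in (0 : ℝ)..1, (a (y / ε))⁻¹ := by
    rw [eq_div_iff hne]; linarith
  rw [← hceq]
  exact hc

lemma IsSolution.eqOn (ha : Continuous a) (hpos : ∀ x, 0 < a x)
    (hf : ContDiffOn ℝ 1 f (Icc 0 1)) (hu : IsSolution a ε f u) (hv : IsSolution a ε f v) :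
    EqOn u v (Icc 0 1) := by
  intro x hx
  have h1 := integral_derivWithin_Icc hu.contDiffOn hx
  have h2 := integral_derivWithin_Icc hv.contDiffOn hx
  rw [hu.left, sub_zero] at h1
  rw [hv.left, sub_zero] at h2
  rw [← h1, ← h2]
  refine intervalIntegral.integral_congr fun t ht => ?_
  rw [uIcc_of_le hx.1] at ht
  have ht' : t ∈ Icc (0 : ℝ) 1 := ⟨ht.1, ht.2.trans hx.2⟩
  simp only [hu.derivWithin_eq ha hpos hf t ht', hv.derivWithin_eq ha hpos hf t ht']

lemma exists_isSolution (ha : Continuous a) (hpos : ∀ x, 0 < a x)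
    (hf : ContDiffOn ℝ 1 f (Icc 0 1)) : ∃ u, IsSolution a ε f u := by
  -- Nothing is known about `f` outside the interval; the constant extension makes the integrand
  -- continuous on the line, so the primitive is differentiable at the endpoints too.
  set F : ℝ → ℝ := IccExtend zero_le_one ((Icc (0 : ℝ) 1).domRestrict f) with hF
  have hFc : Continuous F := hf.continuousOn.domRestrict.Icc_extend'
  have hFf : ∀ x ∈ Icc (0 : ℝ) 1, F x = f x := fun x hx => by
    rw [hF, IccExtend_of_mem _ _ hx, domRestrict_apply]
  have hb := continuous_inv_comp_div (ε := ε) ha hpos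
  have hne := (integral_inv_pos (ε := ε) ha hpos).ne'
  set c := (∫ y in (0 : ℝ)..1, (a (y / ε))⁻¹ * F y) / ∫ y in (0 : ℝ)..1, (a (y / ε))⁻¹ with hc
  have hw : Continuous fun x => (a (x / ε))⁻¹ * (F x - c) := hb.mul (hFc.sub continuous_const)
  have hd : ∀ x, HasDerivAt (fun y => ∫ t in (0 : ℝ)..y, (a (t / ε))⁻¹ * (F t - c))
      ((a (x / ε))⁻¹ * (F x - c)) x := fun x => hw.integral_hasStrictDerivAt 0 x |>.hasDerivAt
  have hdw : ∀ x ∈ Icc (0 : ℝ) 1, derivWithin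
      (fun y => ∫ t in (0 : ℝ)..y, (a (t / ε))⁻¹ * (F t - c)) (Icc 0 1) x
      = (a (x / ε))⁻¹ * (F x - c) := fun x hx =>
    (hd x).hasDerivWithinAt.derivWithin (uniqueDiffOn_Icc zero_lt_one x hx)
  refine ⟨fun x => ∫ t in (0 : ℝ)..x, (a (t / ε))⁻¹ * (F t - c), ?_, ?_, by simp, ?_⟩
  · refine ContDiff.contDiffOn (contDiff_one_iff_deriv.2 ⟨fun x => (hd x).differentiableAt, ?_⟩)
    rw [show deriv (fun y => ∫ t in (0 : ℝ)..y, (a (t / ε))⁻¹ * (F t - c)) =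
      fun x => (a (x / ε))⁻¹ * (F x - c) from funext fun x => (hd x).deriv]
    exact hw
  · intro x hx
    have h1 := ((hf.differentiableOn one_ne_zero x
      (Ioo_subset_Icc_self hx)).hasDerivWithinAt).hasDerivAt (Icc_mem_nhds hx.1 hx.2)
    refine (h1.sub_const c).congr_of_eventuallyEq ?_
    filter_upwards [Icc_mem_nhds hx.1 hx.2] with y hy
    rw [hdw y hy, hFf y hy, mul_inv_cancel_left₀ (hpos _).ne']
  · rw [integral_mul_sub_const hb.continuousOn hFc.continuousOn, hc, div_mul_cancel₀ _ hne, sub_self]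

lemma IsSolution.observable_eq (ha : Continuous a) (hpos : ∀ x, 0 < a x)
    (hf : ContDiffOn ℝ 1 f (Icc 0 1)) (hg : ContDiffOn ℝ 1 g (Icc 0 1))
    (hu : IsSolution a ε f u) :
    observable u g = (∫ x in (0 : ℝ)..1, (a (x / ε))⁻¹ * (f x * g x)) -
      (∫ x in (0 : ℝ)..1, (a (x / ε))⁻¹ * f x) * (∫ x in (0 : ℝ)..1, (a (x / ε))⁻¹ * g x) /
        ∫ x in (0 : ℝ)..1, (a (x / ε))⁻¹ := by
  have hb := (continuous_inv_comp_div (ε := ε) ha hpos).continuousOn (s := Icc 0 1)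
  set c := (∫ y in (0 : ℝ)..1, (a (y / ε))⁻¹ * f y) / ∫ y in (0 : ℝ)..1, (a (y / ε))⁻¹ with hc
  have : observable u g =
      ∫ x in (0 : ℝ)..1, ((a (x / ε))⁻¹ * (f x * g x) - c * ((a (x / ε))⁻¹ * g x)) := by
    refine intervalIntegral.integral_congr fun x hx => ?_
    rw [uIcc_of_le zero_le_one] at hx
    simp only [hu.derivWithin_eq ha hpos hf x hx]
    ring
  rw [this, intervalIntegral.integral_sub, intervalIntegral.integral_const_mul, hc]
  · ring
  · exact (hb.mul (hf.continuousOn.mul hg.continuousOn)).intervalIntegrable_of_Icc zero_le_one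
  · exact (continuousOn_const.mul (hb.mul hg.continuousOn)).intervalIntegrable_of_Icc zero_le_one

/-- For positive `b`, this is `∫ b` times a covariance under the normalized density `b / ∫ b`, hence
blind to constants. It allows `f` and `g` to be centered. -/
lemma weighted_covariance_sub_const {b f g : ℝ → ℝ} (hb : ContinuousOn b (Icc 0 1))
    (hf : ContinuousOn f (Icc 0 1)) (hg : ContinuousOn g (Icc 0 1))
    (hne : ∫ x in (0 : ℝ)..1, b x ≠ 0) (p q : ℝ) :
    (∫ x in (0 : ℝ)..1, b x * ((f x - p) * (g x - q))) -
      (∫ x in (0 : ℝ)..1, b x * (f x - p)) * (∫ x in (0 : ℝ)..1, b x * (g x - q)) /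
        (∫ x in (0 : ℝ)..1, b x) =
    (∫ x in (0 : ℝ)..1, b x * (f x * g x)) -
      (∫ x in (0 : ℝ)..1, b x * f x) * (∫ x in (0 : ℝ)..1, b x * g x) /
        ∫ x in (0 : ℝ)..1, b x := by
  have hi : ∀ {h : ℝ → ℝ}, ContinuousOn h (Icc 0 1) → IntervalIntegrable h volume 0 1 :=
    fun hh => hh.intervalIntegrable_of_Icc zero_le_one
  have h3 : ∫ x in (0 : ℝ)..1, b x * ((f x - p) * (g x - q)) =
      (∫ x in (0 : ℝ)..1, b x * (f x * g x)) - p * (∫ x in (0 : ℝ)..1, b x * g x) -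
        q * (∫ x in (0 : ℝ)..1, b x * (f x - p)) := by
    rw [← intervalIntegral.integral_const_mul, ← intervalIntegral.integral_const_mul,
      ← intervalIntegral.integral_sub (hi (by fun_prop)) (hi (by fun_prop)),
      ← intervalIntegral.integral_sub (hi (by fun_prop)) (hi (by fun_prop))]
    exact intervalIntegral.integral_congr fun x _ => by ring
  rw [h3, integral_mul_sub_const hb hf, integral_mul_sub_const hb hg]
  field_simp
  ring

end BoundaryValueProblem

/-! ### Regular modifications, exponential moments and covariance of the Gaussian field. -/

section GaussianField

open Filter Topology

variable {Ω : Type*} [MeasurableSpace Ω] {P : Measure Ω} {G : ℝ → Ω → ℝ} {C : ℝ → ℝ}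

/-- An almost surely continuous process agrees, outside a null set independent of the parameter,
with a measurable process all of whose paths are continuous. -/
lemma exists_continuous_measurable_modification (hm : ∀ x, AEMeasurable (G x) P)
    (hcont : ∀ᵐ ω ∂P, Continuous fun x => G x ω) :
    ∃ G' : ℝ → Ω → ℝ, (∀ ω, Continuous fun x => G' x ω) ∧ (∀ x, Measurable (G' x)) ∧
      ∀ᵐ ω ∂P, ∀ x, G' x ω = G x ω := by
  classical
  have hgood : ∀ᵐ ω ∂P, (Continuous fun x => G x ω) ∧
      ∀ q : ℚ, G q ω = (hm q).mk (G q) ω :=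
    hcont.and (ae_all_iff.2 fun q => (hm q).ae_eq_mk)
  -- The field is set to zero on a measurable null set containing all bad paths.
  obtain ⟨N, hNsub, hNm, hN0⟩ := exists_measurable_superset_of_null (ae_iff.1 hgood)
  have hN : ∀ ω ∉ N, (Continuous fun x => G x ω) ∧ ∀ q : ℚ, G q ω = (hm q).mk (G q) ω := by
    intro ω hω
    by_contra h
    exact hω (hNsub h)
  refine ⟨fun x => Nᶜ.indicator (G x), fun ω => ?_, fun x => ?_, ?_⟩
  · by_cases hω : ω ∈ N
    · simp [hω, continuous_const]
    · simpa [hω] using (hN ω hω).1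
  -- Off `N`, path continuity exhibits `G x` as a limit of the measurable versions at rational
  -- points.
  · obtain ⟨q, hq⟩ : ∃ q : ℕ → ℚ, Tendsto (fun n => (q n : ℝ)) atTop (𝓝 x) := by
      have hx : x ∈ closure (range ((↑) : ℚ → ℝ)) := Rat.isDenseEmbedding_coe_real.dense x
      obtain ⟨y, hy, hlim⟩ := mem_closure_iff_seq_limit.1 hx
      choose q hq using hy
      exact ⟨q, by simpa [hq] using hlim⟩
    refine measurable_of_tendsto_metrizable
      (f := fun n => Nᶜ.indicator ((hm (q n)).mk (G (q n))))
      (fun n => (hm (q n)).measurable_mk.indicator hNm.compl) (tendsto_pi_nhds.2 fun ω => ?_)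
    by_cases hω : ω ∈ N
    · simp [hω]
    · have h := ((hN ω hω).1.tendsto x).comp hq
      have he : ∀ n, (hm (q n)).mk (G (q n)) ω = G (q n) ω := fun n => ((hN ω hω).2 (q n)).symm
      simpa [hω, he, Function.comp_def] using h
  · filter_upwards [measure_eq_zero_iff_ae_notMem.1 hN0] with ω hω x
    simp [hω]

lemma IsStationaryGaussianField.congr {G' : ℝ → Ω → ℝ} (hG : IsStationaryGaussianField P G C)
    (h : ∀ x, G x =ᵐ[P] G' x) : IsStationaryGaussianField P G' C where
  gaussian := hG.gaussian.congr h
  mean_zero x := by rw [← integral_congr_ae (h x), hG.mean_zero]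
  cov_eq x y := by
    rw [← hG.cov_eq x y]
    unfold covariance
    rw [integral_congr_ae (h x), integral_congr_ae (h y)]
    refine integral_congr_ae ?_
    filter_upwards [h x, h y] with ω h1 h2
    rw [h1, h2]

namespace IsStationaryGaussianField

lemma memLp (hG : IsStationaryGaussianField P G C) (x : ℝ) : MemLp (G x) 2 P :=
  (hG.gaussian.hasGaussianLaw_eval x).memLp_two

lemma even (hG : IsStationaryGaussianField P G C) (x : ℝ) : C (-x) = C x := by
  have h1 := hG.cov_eq x 0
  have h2 := hG.cov_eq 0 x
  rw [covariance_comm, h1] at h2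
  simpa using h2.symm

lemma integral_mul (hG : IsStationaryGaussianField P G C) (x y : ℝ) :
    ∫ ω, G x ω * G y ω ∂P = C (x - y) := by
  rw [← hG.cov_eq x y, covariance, hG.mean_zero, hG.mean_zero]
  simp

lemma hasGaussianLaw_sum (hG : IsStationaryGaussianField P G C) {n : ℕ} (c x : Fin n → ℝ) :
    HasGaussianLaw (fun ω => ∑ i, c i * G (x i) ω) P :=
  ((hG.gaussian.comp_right x).smul c).hasGaussianLaw_fun_sum

lemma map_sum_eq_gaussianReal (hG : IsStationaryGaussianField P G C) {n : ℕ} (c x : Fin n → ℝ) :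
    P.map (fun ω => ∑ i, c i * G (x i) ω) =
      gaussianReal 0 (∑ i, ∑ j, c i * c j * C (x i - x j)).toNNReal := by
  have := hG.gaussian.isProbabilityMeasure
  have hmem : ∀ i, MemLp (fun ω => c i * G (x i) ω) 2 P := fun i => (hG.memLp (x i)).const_mul _
  rw [(hG.hasGaussianLaw_sum c x).map_eq_gaussianReal, variance_fun_sum hmem]
  congr 2
  · rw [integral_finsetSum _ fun i _ => (hmem i).integrable one_le_two]
    simp [integral_const_mul, hG.mean_zero]
  · refine Finset.sum_congr rfl fun i _ => Finset.sum_congr rfl fun j _ => ?_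
    rw [covariance_const_mul_left, covariance_const_mul_right, hG.cov_eq]
    ring

lemma variance_sum_nonneg (hG : IsStationaryGaussianField P G C) {n : ℕ} (c x : Fin n → ℝ) :
    0 ≤ ∑ i, ∑ j, c i * c j * C (x i - x j) := by
  have := hG.gaussian.isProbabilityMeasure
  have hmem : ∀ i, MemLp (fun ω => c i * G (x i) ω) 2 P := fun i => (hG.memLp (x i)).const_mul _
  have h := variance_nonneg (fun ω => ∑ i, c i * G (x i) ω) P
  rw [variance_fun_sum hmem] at h
  convert! h using 4
  rw [covariance_const_mul_left, covariance_const_mul_right, hG.cov_eq]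
  ring

lemma integrable_exp_sum (hG : IsStationaryGaussianField P G C) {n : ℕ} (c x : Fin n → ℝ) :
    Integrable (fun ω => Real.exp (∑ i, c i * G (x i) ω)) P := by
  have hm := (hG.hasGaussianLaw_sum c x).aemeasurable
  have h := integrable_exp_mul_gaussianReal (μ := 0)
    (v := (∑ i, ∑ j, c i * c j * C (x i - x j)).toNNReal) 1
  rw [← hG.map_sum_eq_gaussianReal, integrable_map_measure (by fun_prop) hm] at h
  simpa [Function.comp_def] using h

lemma integral_exp_sum (hG : IsStationaryGaussianField P G C) {n : ℕ} (c x : Fin n → ℝ) :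
    ∫ ω, Real.exp (∑ i, c i * G (x i) ω) ∂P =
      Real.exp ((∑ i, ∑ j, c i * c j * C (x i - x j)) / 2) := by
  have h := mgf_gaussianReal (hG.map_sum_eq_gaussianReal c x) 1
  rw [mgf, Real.coe_toNNReal _ (hG.variance_sum_nonneg c x)] at h
  simpa using h

lemma integral_cexp_sub (hG : IsStationaryGaussianField P G C) (x y : ℝ) :
    ∫ ω, Complex.exp ((G x ω - G y ω : ℝ) * Complex.I) ∂P =
      Real.exp (-(C 0 - C (x - y))) := by
  have := hG.gaussian.isProbabilityMeasure
  have hmap := hG.map_sum_eq_gaussianReal ![1, -1] ![x, y]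
  have hnn := hG.variance_sum_nonneg ![1, -1] ![x, y]
  have hm := (hG.hasGaussianLaw_sum ![1, -1] ![x, y]).aemeasurable
  have h := charFun_gaussianReal (μ := 0)
    (v := (∑ i, ∑ j, ![1, -1] i * ![1, -1] j * C (![x, y] i - ![x, y] j)).toNNReal) 1
  rw [← hmap, charFun_apply_real, integral_map hm (by fun_prop),
    Real.coe_toNNReal _ hnn] at h
  have hyx : C (y - x) = C (x - y) := by rw [← hG.even, neg_sub]
  simp only [Fin.sum_univ_two, Matrix.cons_val_zero, Matrix.cons_val_one, sub_self, hyx] at h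
  convert! h using 2
  · ext ω
    congr 1
    push_cast
    ring
  · push_cast
    congr 1
    ring

/-- The characteristic function of an increment is `exp (-(C 0 - C x))`. It is bounded, so path
continuity and dominated convergence suffice, with no uniform integrability of `G²`. -/
lemma tendsto_cov_zero (hG : IsStationaryGaussianField P G C)
    (hcont : ∀ᵐ ω ∂P, Continuous fun x => G x ω) : Tendsto C (𝓝 0) (𝓝 (C 0)) := by
  have := hG.gaussian.isProbabilityMeasure
  have h : Tendsto (fun x => ∫ ω, Complex.exp ((G x ω - G 0 ω : ℝ) * Complex.I) ∂P) (𝓝 0)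
      (𝓝 (∫ _, 1 ∂P)) := by
    refine tendsto_integral_filter_of_dominated_convergence (fun _ => 1)
      (Eventually.of_forall fun x => ?_) (Eventually.of_forall fun x => ?_)
      (integrable_const _) ?_
    · have h1 := (hG.gaussian.aemeasurable x).sub (hG.gaussian.aemeasurable 0)
      exact (Complex.measurable_exp.comp_aemeasurable
        ((Complex.measurable_ofReal.comp_aemeasurable h1).mul_const _)).aestronglyMeasurable
    · exact Eventually.of_forall fun ω => (Complex.norm_exp_ofReal_mul_I _).le
    · filter_upwards [hcont] with ω hω
      have h0 : Continuous fun x => Complex.exp ((G x ω - G 0 ω : ℝ) * Complex.I) := by fun_prop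
      simpa using h0.tendsto 0
  simp only [hG.integral_cexp_sub, sub_zero, integral_const, probReal_univ,
    one_smul] at h
  have h2 : Tendsto (fun x => Real.exp (-(C 0 - C x))) (𝓝 0) (𝓝 1) := by
    have := (Complex.continuous_re.tendsto 1).comp h
    simpa only [Function.comp_def, Complex.ofReal_re, Complex.one_re] using this
  have h3 := ((Real.continuousAt_log one_ne_zero).tendsto.comp h2).add_const (C 0)
  simpa [Function.comp_def] using h3

lemma cov_zero_nonneg (hG : IsStationaryGaussianField P G C) : 0 ≤ C 0 := by
  simpa using hG.variance_sum_nonneg ![1] ![0]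

/-- If `C 0 = 0`, each `G x` vanishes almost surely; simultaneity over rational `x` and path
continuity then kill the whole field. -/
lemma cov_zero_pos (hG : IsStationaryGaussianField P G C)
    (hcont : ∀ᵐ ω ∂P, Continuous fun x => G x ω) (hne : ¬ ∀ᵐ ω ∂P, ∀ x, G x ω = 0) : 0 < C 0 := by
  have := hG.gaussian.isProbabilityMeasure
  refine hG.cov_zero_nonneg.lt_of_ne' fun h0 => hne ?_
  have hx : ∀ x, ∀ᵐ ω ∂P, G x ω = 0 := fun x => by
    have hv : Var[G x; P] = 0 := by
      rw [← covariance_self (hG.memLp x).aemeasurable, hG.cov_eq, sub_self, h0]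
    have := ae_eq_integral_of_variance_eq_zero (hG.memLp x) hv
    simpa [hG.mean_zero] using this
  filter_upwards [hcont, ae_all_iff.2 fun q : ℚ => hx q] with ω hω hq x
  have := Rat.isDenseEmbedding_coe_real.dense.equalizer hω (continuous_const (y := (0 : ℝ)))
    (funext hq)
  exact congrFun this x

/-- All mixed moments of `1/a` needed later; zero exponents cover fewer than four points. The
variance of the Gaussian exponent splits into diagonal and pair terms, hence the product over pairs.
-/
lemma integrable_prod_pow_and_integral (hG : IsStationaryGaussianField P G C) (x : Fin 4 → ℝ)
    (n : Fin 4 → ℕ) :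
    Integrable (fun ω => ∏ i, Real.exp (-G (x i) ω) ^ n i) P ∧
    ∫ ω, ∏ i, Real.exp (-G (x i) ω) ^ n i ∂P =
      Real.exp (C 0 / 2) ^ (n 0 ^ 2 + n 1 ^ 2 + n 2 ^ 2 + n 3 ^ 2) *
      (Real.exp (C (x 0 - x 1)) ^ (n 0 * n 1) * Real.exp (C (x 0 - x 2)) ^ (n 0 * n 2) *
       Real.exp (C (x 0 - x 3)) ^ (n 0 * n 3) * Real.exp (C (x 1 - x 2)) ^ (n 1 * n 2) *
       Real.exp (C (x 1 - x 3)) ^ (n 1 * n 3) * Real.exp (C (x 2 - x 3)) ^ (n 2 * n 3)) := by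
  have he : (fun ω => ∏ i, Real.exp (-G (x i) ω) ^ n i) =
      fun ω => Real.exp (∑ i, (-(n i : ℝ)) * G (x i) ω) := by
    ext ω
    rw [Real.exp_sum]
    refine Finset.prod_congr rfl fun i _ => ?_
    rw [← Real.exp_nat_mul]
    congr 1
    ring
  rw [he]
  refine ⟨hG.integrable_exp_sum _ _, ?_⟩
  rw [hG.integral_exp_sum]
  simp only [← Real.exp_nat_mul, ← Real.exp_add]
  congr 1
  have hs : ∀ i j, C (x i - x j) = C (x j - x i) := fun i j => by rw [← hG.even, neg_sub]
  simp only [Fin.sum_univ_four, sub_self, hs 1 0, hs 2 0, hs 3 0, hs 2 1, hs 3 1, hs 3 2]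
  push_cast
  ring

end IsStationaryGaussianField

end GaussianField

/-! ### Second moments of integrals of a random field over a parameter. -/

section SecondMoment

variable {Ω S : Type*} [MeasurableSpace Ω] [MeasurableSpace S] {P : Measure Ω}
  [IsProbabilityMeasure P] {μ : Measure S} [IsFiniteMeasure μ] {Z : S → Ω → ℝ} {M : ℝ}

/-- The uniform bound on second moments, with `2|zw| ≤ z² + w²`, justifies Fubini for the square of
a parameter integral. -/
lemma integrable_prod_mul_of_sq_le (hZ : Measurable (Function.uncurry Z))
    (hint : ∀ s, MemLp (Z s) 2 P) (hM : ∀ s, ∫ ω, Z s ω ^ 2 ∂P ≤ M) :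
    Integrable (fun q : (S × S) × Ω => Z q.1.1 q.2 * Z q.1.2 q.2) ((μ.prod μ).prod P) := by
  have hmeas : Measurable fun q : (S × S) × Ω => Z q.1.1 q.2 * Z q.1.2 q.2 :=
    (hZ.comp ((measurable_fst.comp measurable_fst).prodMk measurable_snd)).mul
      (hZ.comp ((measurable_snd.comp measurable_fst).prodMk measurable_snd))
  rw [integrable_prod_iff hmeas.aestronglyMeasurable]
  refine ⟨Filter.Eventually.of_forall fun p => (hint p.1).integrable_mul (hint p.2), ?_⟩
  refine Integrable.of_bound (C := M)
    (hmeas.norm.stronglyMeasurable.integral_prod_right').aestronglyMeasurable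
    (Filter.Eventually.of_forall fun p => ?_)
  rw [Real.norm_of_nonneg (integral_nonneg fun _ => norm_nonneg _)]
  have h1 := (hint p.1).integrable_sq
  have h2 := (hint p.2).integrable_sq
  calc ∫ ω, ‖Z p.1 ω * Z p.2 ω‖ ∂P
      ≤ ∫ ω, (1 / 2 * Z p.1 ω ^ 2 + 1 / 2 * Z p.2 ω ^ 2) ∂P := by
        refine integral_mono ((hint p.1).integrable_mul (hint p.2)).norm
          ((h1.const_mul _).add (h2.const_mul _)) fun ω => ?_
        simp only [Real.norm_eq_abs, abs_mul]
        nlinarith [sq_nonneg (|Z p.1 ω| - |Z p.2 ω|), sq_abs (Z p.1 ω), sq_abs (Z p.2 ω)]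
    _ = 1 / 2 * ∫ ω, Z p.1 ω ^ 2 ∂P + 1 / 2 * ∫ ω, Z p.2 ω ^ 2 ∂P := by
        rw [integral_add (h1.const_mul _) (h2.const_mul _), integral_const_mul,
          integral_const_mul]
    _ ≤ M := by linarith [hM p.1, hM p.2]

lemma memLp_two_integral (hZ : Measurable (Function.uncurry Z))
    (hint : ∀ s, MemLp (Z s) 2 P) (hM : ∀ s, ∫ ω, Z s ω ^ 2 ∂P ≤ M) :
    MemLp (fun ω => ∫ s, Z s ω ∂μ) 2 P := by
  have hm : StronglyMeasurable fun ω => ∫ s, Z s ω ∂μ :=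
    (hZ.comp measurable_swap).stronglyMeasurable.integral_prod_right'
  rw [memLp_two_iff_integrable_sq hm.aestronglyMeasurable]
  have h := (integrable_prod_mul_of_sq_le (μ := μ) hZ hint hM).integral_prod_right
  refine h.congr (Filter.Eventually.of_forall fun ω => ?_)
  simp only
  rw [integral_prod_mul (fun s => Z s ω) (fun s => Z s ω), sq]

lemma integral_integral_sq (hZ : Measurable (Function.uncurry Z))
    (hint : ∀ s, MemLp (Z s) 2 P) (hM : ∀ s, ∫ ω, Z s ω ^ 2 ∂P ≤ M) :
    ∫ ω, (∫ s, Z s ω ∂μ) ^ 2 ∂P = ∫ p, ∫ ω, Z p.1 ω * Z p.2 ω ∂P ∂(μ.prod μ) := by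
  rw [integral_integral_swap (f := fun (p : S × S) ω => Z p.1 ω * Z p.2 ω)
    (integrable_prod_mul_of_sq_le hZ hint hM)]
  refine integral_congr_ae (Filter.Eventually.of_forall fun ω => ?_)
  simp only
  rw [integral_prod_mul (fun s => Z s ω) (fun s => Z s ω), sq]

lemma integrable_integral_mul (hZ : Measurable (Function.uncurry Z))
    (hint : ∀ s, MemLp (Z s) 2 P) (hM : ∀ s, ∫ ω, Z s ω ^ 2 ∂P ≤ M) :
    Integrable (fun p : S × S => ∫ ω, Z p.1 ω * Z p.2 ω ∂P) (μ.prod μ) :=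
  (integrable_prod_mul_of_sq_le hZ hint hM).integral_prod_left

end SecondMoment

/-! ### Concentration of a rescaled decaying kernel. -/

section DecayingKernel

variable {ρ h : ℝ → ℝ} {B b ε H : ℝ}

lemma integrable_of_decay (hρ : Measurable ρ) (hb : 1 < b)
    (hdecay : ∀ z, |ρ z| ≤ B * (1 + |z|) ^ (-b)) : Integrable ρ := by
  have h : Integrable fun z : ℝ => (1 + ‖z‖) ^ (-b) := integrable_one_add_norm (by simpa using hb)
  exact (h.const_mul B).mono' hρ.aestronglyMeasurable (Filter.Eventually.of_forall hdecay)

lemma decay_const_nonneg (hdecay : ∀ z, |ρ z| ≤ B * (1 + |z|) ^ (-b)) : 0 ≤ B := by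
  have := (abs_nonneg _).trans (hdecay 0)
  simpa using this

/-- Dropping the `1` gives a homogeneous bound from which `ε ^ b` factors out. Its singularity at
zero is harmless against a Lipschitz difference when `b < 2`. -/
lemma decay_div_le (hb : 0 < b) (hε : 0 < ε)
    (hdecay : ∀ z, |ρ z| ≤ B * (1 + |z|) ^ (-b)) {z : ℝ} (hz : z ≠ 0) :
    |ρ (z / ε)| ≤ B * ε ^ b * |z| ^ (-b) := by
  have hB := decay_const_nonneg hdecay
  have hz' : 0 < |z| := abs_pos.2 hz
  refine (hdecay _).trans ?_
  rw [mul_assoc]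
  refine mul_le_mul_of_nonneg_left ?_ hB
  have h1 : |z / ε| = |z| / ε := by rw [abs_div, abs_of_pos hε]
  calc (1 + |z / ε|) ^ (-b) ≤ (|z| / ε) ^ (-b) := by
        rw [h1]
        exact Real.rpow_le_rpow_of_nonpos (by positivity) (by linarith) (by linarith)
    _ = ε ^ b * |z| ^ (-b) := by
        rw [Real.div_rpow hz'.le hε.le, Real.rpow_neg hε.le, div_inv_eq_mul, mul_comm]

lemma abs_integral_Ioi_div_le (hb : 1 < b) (hε : 0 < ε)
    (hdecay : ∀ z, |ρ z| ≤ B * (1 + |z|) ^ (-b)) {s : ℝ} (hs : 0 < s) :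
    |∫ t in Ioi s, ρ (t / ε)| ≤ B * ε ^ b * (s ^ (1 - b) / (b - 1)) := by
  have hint : IntegrableOn (fun t : ℝ => B * ε ^ b * t ^ (-b)) (Ioi s) :=
    (integrableOn_Ioi_rpow_of_lt (by linarith) hs).const_mul _
  have hle := norm_integral_le_of_norm_le (f := fun t => ρ (t / ε)) hint
    ((ae_restrict_iff' measurableSet_Ioi).2 (Filter.Eventually.of_forall fun t ht => by
      have ht0 : 0 < t := hs.trans ht
      have := decay_div_le (by linarith) hε hdecay ht0.ne'
      rwa [abs_of_pos ht0] at this))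
  rw [integral_const_mul, integral_Ioi_rpow_of_lt (by linarith) hs] at hle
  refine hle.trans (le_of_eq ?_)
  rw [show -b + 1 = -(b - 1) by ring, show 1 - b = -(b - 1) by ring, neg_div_neg_eq]

lemma integral_comp_sub_div (ρ : ℝ → ℝ) (hε : 0 < ε) (x : ℝ) :
    ∫ y, ρ ((x - y) / ε) = ε * ∫ z, ρ z := by
  rw [integral_sub_left_eq_self (fun z => ρ (z / ε)) volume x, Measure.integral_comp_div,
    abs_of_pos hε, smul_eq_mul]

/-- The boundary layer: kernel mass leaking out of the interval, controlled by the distances from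
`x` to the two endpoints. For `b < 2` this bound is integrable in `x`. -/
lemma abs_integral_compl_Ioc_le (hρ : Measurable ρ) (hb : 1 < b) (hε : 0 < ε)
    (hdecay : ∀ z, |ρ z| ≤ B * (1 + |z|) ^ (-b)) {x : ℝ} (hx : x ∈ Ioo (0 : ℝ) 1) :
    |∫ y in (Ioc (0 : ℝ) 1)ᶜ, ρ ((x - y) / ε)| ≤
      B * ε ^ b * ((x ^ (1 - b) + (1 - x) ^ (1 - b)) / (b - 1)) := by
  have hi : Integrable fun y => ρ ((x - y) / ε) :=
    ((integrable_of_decay hρ hb hdecay).comp_div hε.ne').comp_sub_left x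
  have hset : (Ioc (0 : ℝ) 1)ᶜ = Iic 0 ∪ Ioi 1 := by
    ext y; simp [imp_iff_not_or]
  have hdisj : Disjoint (Iic (0 : ℝ)) (Ioi 1) :=
    Set.disjoint_left.2 fun y h1 h2 => by
      simp only [mem_Iic, mem_Ioi] at h1 h2; linarith
  rw [hset, setIntegral_union hdisj measurableSet_Ioi hi.integrableOn hi.integrableOn]
  have h1 : ∫ y in Iic (0 : ℝ), ρ ((x - y) / ε) = ∫ t in Ioi x, ρ (t / ε) := by
    rw [← integral_Ici_eq_integral_Ioi,
      ← (Measure.measurePreserving_sub_left volume x).setIntegral_preimage_emb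
        (measurableEmbedding_subLeft x) (fun t => ρ (t / ε)) (Ici x)]
    congr 2
    ext y; simp
  have h2 : ∫ y in Ioi (1 : ℝ), ρ ((x - y) / ε) = ∫ t in Ioi (1 - x), ρ (-(t / ε)) := by
    rw [← (measurePreserving_sub_right volume x).setIntegral_preimage_emb
      (measurableEmbedding_subRight x) (fun t => ρ (-(t / ε))) (Ioi (1 - x))]
    rw [show (fun y => y - x) ⁻¹' Ioi (1 - x) = Ioi 1 by ext y; simp]
    refine setIntegral_congr_fun measurableSet_Ioi fun y _ => congrArg ρ ?_
    ring
  have h3 := abs_integral_Ioi_div_le hb hε hdecay hx.1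
  have h4 := abs_integral_Ioi_div_le (ρ := fun z => ρ (-z)) (s := 1 - x) hb hε
    (fun z => by simpa using hdecay (-z)) (by linarith [hx.2])
  rw [h1, h2]
  refine (abs_add_le _ _).trans ((add_le_add h3 h4).trans (le_of_eq ?_))
  ring

lemma integrableOn_abs_rpow {s : ℝ} (hs : -1 < s) :
    IntegrableOn (fun t : ℝ => |t| ^ s) (Icc (-1) 1) := by
  have h1 : IntervalIntegrable (fun t : ℝ => |t| ^ s) volume 0 1 := by
    refine (intervalIntegral.intervalIntegrable_rpow' hs).congr fun t ht => ?_
    rw [uIoc_of_le zero_le_one] at ht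
    simp only [abs_of_pos ht.1]
  have h2 : IntervalIntegrable (fun t : ℝ => |t| ^ s) volume (-1) 0 := by
    have := ((IntervalIntegrable.iff_comp_neg (by finiteness)).1 h1).symm
    simpa using this
  have := h2.trans h1
  rwa [intervalIntegrable_iff_integrableOn_Icc_of_le (by norm_num)] at this

lemma setIntegral_Ioc_abs_sub_rpow_le {s : ℝ} (hs : -1 < s) {x : ℝ} (hx : x ∈ Icc (0 : ℝ) 1) :
    IntegrableOn (fun y => |x - y| ^ s) (Ioc 0 1) ∧
    ∫ y in Ioc (0 : ℝ) 1, |x - y| ^ s ≤ ∫ t in Icc (-1 : ℝ) 1, |t| ^ s := by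
  have hsub : Ioc (0 : ℝ) 1 ⊆ (fun y => x - y) ⁻¹' Icc (-1) 1 := fun y hy => by
    simp only [mem_preimage, mem_Icc]
    constructor <;> linarith [hx.1, hx.2, hy.1, hy.2]
  have hmp := Measure.measurePreserving_sub_left (volume : Measure ℝ) x
  have hme := measurableEmbedding_subLeft x
  have hi : IntegrableOn (fun y => |x - y| ^ s) ((fun y => x - y) ⁻¹' Icc (-1) 1) :=
    (hmp.integrableOn_comp_preimage hme (f := fun t => |t| ^ s)).2 (integrableOn_abs_rpow hs)
  refine ⟨hi.mono_set hsub, ?_⟩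
  rw [← hmp.setIntegral_preimage_emb hme (fun t => |t| ^ s) (Icc (-1) 1)]
  exact setIntegral_mono_set hi (Filter.Eventually.of_forall fun y => by positivity)
    hsub.eventuallyLE

lemma integrableOn_rpow_add_rpow {s : ℝ} (hs : -1 < s) :
    IntegrableOn (fun x : ℝ => x ^ s + (1 - x) ^ s) (Ioc 0 1) := by
  rw [← intervalIntegrable_iff_integrableOn_Ioc_of_le zero_le_one]
  have h : IntervalIntegrable (fun x : ℝ => x ^ s) volume 0 1 :=
    intervalIntegral.intervalIntegrable_rpow' hs
  have h2 := (h.comp_sub_left 1).symm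
  simp only [sub_zero, sub_self] at h2
  exact h.add h2

/-- Quantitative concentration of a rescaled decaying kernel on the diagonal, tested against a
bounded function that is Lipschitz on the unit interval. -/
lemma exists_kernel_concentration (hb : 1 < b) (hb' : b < 2) :
    ∃ K, 0 ≤ K ∧ ∀ (ρ h : ℝ → ℝ) (B H ε : ℝ), Measurable ρ → Measurable h → 0 < ε →
      (∀ z, |ρ z| ≤ B * (1 + |z|) ^ (-b)) → (∀ x, |h x| ≤ H) →
      (∀ x ∈ Icc (0 : ℝ) 1, ∀ y ∈ Icc (0 : ℝ) 1, |h x - h y| ≤ H * |x - y|) →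
      |(∫ p, h p.1 * h p.2 * ρ ((p.1 - p.2) / ε)
          ∂((volume.restrict (Ioc (0 : ℝ) 1)).prod (volume.restrict (Ioc (0 : ℝ) 1)))) -
        ε * (∫ z, ρ z) * ∫ x in Ioc (0 : ℝ) 1, h x ^ 2| ≤ K * B * H ^ 2 * ε ^ b := by
  set L := ∫ t in Icc (-1 : ℝ) 1, |t| ^ (1 - b) with hL
  have hL0 : 0 ≤ L := integral_nonneg fun t => by positivity
  have hs : -1 < 1 - b := by linarith
  -- `L` pays for the variation of `h`, the other summand for the boundary layer.
  refine ⟨∫ x in Ioc (0 : ℝ) 1, (L + (x ^ (1 - b) + (1 - x) ^ (1 - b)) / (b - 1)), ?_, ?_⟩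
  · refine setIntegral_nonneg measurableSet_Ioc fun x hx => ?_
    have h1 : 0 ≤ x ^ (1 - b) := Real.rpow_nonneg hx.1.le _
    have h2 : 0 ≤ (1 - x) ^ (1 - b) := Real.rpow_nonneg (by linarith [hx.2]) _
    have : 0 < b - 1 := by linarith
    positivity
  intro ρ h B H ε hρ hh hε hdecay hH hLip
  have hB := decay_const_nonneg hdecay
  have hH0 : 0 ≤ H := (abs_nonneg _).trans (hH 0)
  have hρB : ∀ z, |ρ z| ≤ B := fun z => (hdecay z).trans (by
    have : (1 + |z|) ^ (-b) ≤ 1 :=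
      Real.rpow_le_one_of_one_le_of_nonpos (by linarith [abs_nonneg z]) (by linarith)
    nlinarith)
  have hρi := integrable_of_decay hρ hb hdecay
  have hki : ∀ x, Integrable fun y => ρ ((x - y) / ε) := fun x =>
    (hρi.comp_div hε.ne').comp_sub_left x
  have hprod : Integrable (fun p : ℝ × ℝ => h p.1 * h p.2 * ρ ((p.1 - p.2) / ε))
      ((volume.restrict (Ioc (0 : ℝ) 1)).prod (volume.restrict (Ioc (0 : ℝ) 1))) := by
    refine Integrable.of_bound (C := H * H * B) (by fun_prop) (Filter.Eventually.of_forall fun p => ?_)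
    rw [norm_mul, norm_mul]
    gcongr
    exacts [hH _, hH _, hρB _]
  have hsq : Integrable (fun x => h x ^ 2) (volume.restrict (Ioc (0 : ℝ) 1)) := by
    refine Integrable.of_bound (C := H ^ 2) (by fun_prop) (Filter.Eventually.of_forall fun x => ?_)
    rw [norm_pow]
    gcongr
    exact hH _
  rw [integral_prod _ hprod, ← integral_const_mul, ← integral_sub hprod.integral_prod_left
    (hsq.const_mul _)]
  have hbound : IntegrableOn (fun x : ℝ => B * H ^ 2 * ε ^ b *
      (L + (x ^ (1 - b) + (1 - x) ^ (1 - b)) / (b - 1))) (Ioc 0 1) := by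
    refine Integrable.const_mul (Integrable.add (integrable_const L) ?_) _
    exact (integrableOn_rpow_add_rpow hs).div_const _
  have hpt : ∀ᵐ x ∂(volume.restrict (Ioc (0 : ℝ) 1)),
      ‖(∫ y in Ioc (0 : ℝ) 1, h x * h y * ρ ((x - y) / ε)) - ε * (∫ z, ρ z) * h x ^ 2‖ ≤
      B * H ^ 2 * ε ^ b * (L + (x ^ (1 - b) + (1 - x) ^ (1 - b)) / (b - 1)) := by
    -- The boundary-layer bound needs `x` strictly inside, so the endpoint `1` is discarded as a
    -- null set.
    refine (ae_restrict_iff' measurableSet_Ioc).2 ((Measure.ae_ne volume 1).mono fun x hx1 hx' => ?_)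
    have hx : x ∈ Ioo (0 : ℝ) 1 := ⟨hx'.1, hx'.2.lt_of_ne hx1⟩
    have hxI := Ioo_subset_Icc_self hx
    obtain ⟨hi1, hi2⟩ := setIntegral_Ioc_abs_sub_rpow_le hs hxI
    have hk1 : Integrable (fun y => h x * h y * ρ ((x - y) / ε))
        (volume.restrict (Ioc (0 : ℝ) 1)) := by
      refine Integrable.of_bound (C := H * H * B) (by fun_prop)
        (Filter.Eventually.of_forall fun y => ?_)
      rw [norm_mul, norm_mul]
      gcongr
      exacts [hH _, hH _, hρB _]
    -- Replace `h y` by `h x + (h y - h x)`, and write the kernel mass on the interval as the full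
    -- mass `ε ∫ ρ` minus the mass outside.
    have hsplit : (∫ y in Ioc (0 : ℝ) 1, h x * h y * ρ ((x - y) / ε)) -
        ε * (∫ z, ρ z) * h x ^ 2 =
        (∫ y in Ioc (0 : ℝ) 1, h x * (h y - h x) * ρ ((x - y) / ε)) -
          h x ^ 2 * ∫ y in (Ioc (0 : ℝ) 1)ᶜ, ρ ((x - y) / ε) := by
      rw [← integral_comp_sub_div ρ hε x, ← integral_add_compl measurableSet_Ioc (hki x)]
      have : ∫ y in Ioc (0 : ℝ) 1, h x * (h y - h x) * ρ ((x - y) / ε) =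
          (∫ y in Ioc (0 : ℝ) 1, h x * h y * ρ ((x - y) / ε)) -
            h x ^ 2 * ∫ y in Ioc (0 : ℝ) 1, ρ ((x - y) / ε) := by
        rw [← integral_const_mul, ← integral_sub hk1 ((hki x).integrableOn.const_mul _)]
        congr 1
        ext y
        ring
      rw [this]
      ring
    have hT1 : ‖∫ y in Ioc (0 : ℝ) 1, h x * (h y - h x) * ρ ((x - y) / ε)‖ ≤
        B * H ^ 2 * ε ^ b * L := by
      refine (norm_integral_le_of_norm_le (hi1.const_mul (B * H ^ 2 * ε ^ b)) ?_).trans ?_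
      · rw [ae_restrict_iff' measurableSet_Ioc]
        refine Filter.Eventually.of_forall fun y hy => ?_
        rcases eq_or_ne x y with rfl | hxy
        · simp only [sub_self, mul_zero, zero_mul, norm_zero]
          positivity
        have hz : x - y ≠ 0 := sub_ne_zero.2 hxy
        have hz' : 0 < |x - y| := abs_pos.2 hz
        have h1 := decay_div_le (by linarith) hε hdecay hz
        have h2 := hLip x hxI y (Ioc_subset_Icc_self hy)
        rw [norm_mul, norm_mul, Real.norm_eq_abs, Real.norm_eq_abs, Real.norm_eq_abs,
          abs_sub_comm (h y)]
        calc |h x| * |h x - h y| * |ρ ((x - y) / ε)|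
            ≤ H * (H * |x - y|) * (B * ε ^ b * |x - y| ^ (-b)) := by
              gcongr
              exact hH x
          -- The Lipschitz factor raises the exponent from `-b` to `1 - b > -1`, which is
          -- integrable.
          _ = B * H ^ 2 * ε ^ b * (|x - y| ^ (1 : ℝ) * |x - y| ^ (-b)) := by
              rw [Real.rpow_one]; ring
          _ = B * H ^ 2 * ε ^ b * |x - y| ^ (1 - b) := by
              rw [← Real.rpow_add hz', ← sub_eq_add_neg]
      · rw [integral_const_mul]
        gcongr
    have hT2 := abs_integral_compl_Ioc_le hρ hb hε hdecay hx
    rw [hsplit]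
    refine (norm_sub_le _ _).trans ?_
    rw [norm_mul, Real.norm_eq_abs (h x ^ 2), abs_pow, mul_add]
    refine add_le_add hT1 ?_
    calc |h x| ^ 2 * ‖∫ y in (Ioc (0 : ℝ) 1)ᶜ, ρ ((x - y) / ε)‖
        ≤ H ^ 2 * (B * ε ^ b * ((x ^ (1 - b) + (1 - x) ^ (1 - b)) / (b - 1))) := by
          gcongr
          · exact hH x
          · exact hT2
      _ = _ := by ring
  refine (norm_integral_le_of_norm_le hbound hpt).trans (le_of_eq ?_)
  rw [integral_const_mul]
  ring

end DecayingKernel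

/-! ### Two-point and four-point functions of the fluctuation of `1/a`. -/

section FluctuationMoments

/-- The fluctuation of `1 / a = exp (-G)` around its mean `exp (C 0 / 2)`. -/
noncomputable def fluct {Ω : Type*} (G : ℝ → Ω → ℝ) (C : ℝ → ℝ) (x : ℝ) (ω : Ω) : ℝ :=
  Real.exp (-G x ω) - Real.exp (C 0 / 2)

/-- The four-point function of the normalized fluctuation, in terms of the pairwise values
of `exp C - 1`. -/
def fourPoint (r₁₂ r₁₃ r₁₄ r₂₃ r₂₄ r₃₄ : ℝ) : ℝ :=
  r₁₂ * r₃₄ * ((1 + r₁₃) * (1 + r₁₄) * ((1 + r₂₃) * (1 + r₂₄))) +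
  r₁₃ * r₂₄ * ((1 + r₁₄) * (1 + r₂₃) * (1 + r₁₂ + r₃₄)) +
  r₁₄ * r₂₃ * ((1 + r₁₂ + r₃₄) * (1 + r₁₃ + r₂₄)) +
  r₁₂ * r₁₃ * r₁₄ + r₁₂ * r₂₃ * r₂₄ + r₁₃ * r₂₃ * r₃₄ + r₁₄ * r₂₄ * r₃₄

/-- Expanded, the four-point function sums over graphs on four vertices without isolated vertex;
each contains a perfect matching or is a star. Two edges are kept and the rest bounded by `R`. In a
star the edge dropped is `12` or `34`, so that fixing one of the pairs `{1,2}`, `{3,4}` leaves a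
product of two separate integrals. -/
lemma abs_fourPoint_le {r₁₂ r₁₃ r₁₄ r₂₃ r₂₄ r₃₄ R : ℝ} (h₁₂ : |r₁₂| ≤ R) (h₁₃ : |r₁₃| ≤ R)
    (h₁₄ : |r₁₄| ≤ R) (h₂₃ : |r₂₃| ≤ R) (h₂₄ : |r₂₄| ≤ R) (h₃₄ : |r₃₄| ≤ R) :
    |fourPoint r₁₂ r₁₃ r₁₄ r₂₃ r₂₄ r₃₄| ≤ (1 + R) ^ 4 *
      (|r₁₂| * |r₃₄| + |r₁₃| * |r₂₄| + |r₁₄| * |r₂₃| + |r₁₃| * |r₁₄| + |r₂₃| * |r₂₄| +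
        |r₁₃| * |r₂₃| + |r₁₄| * |r₂₄|) := by
  have hR : 0 ≤ R := (abs_nonneg _).trans h₁₂
  have one_add : ∀ {r : ℝ}, |r| ≤ R → |1 + r| ≤ 1 + R := fun h =>
    (abs_add_le _ _).trans (by rw [abs_one]; linarith)
  have two_add : ∀ {r s : ℝ}, |r| ≤ R → |s| ≤ R → |1 + r + s| ≤ (1 + R) * (1 + R) :=
    fun h h' => (abs_add_le _ _).trans (by nlinarith [one_add h])
  have hR4 : R ≤ (1 + R) ^ 4 := by nlinarith [sq_nonneg R, sq_nonneg (R ^ 2 + R)]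
  have t1 : |r₁₂ * r₃₄ * ((1 + r₁₃) * (1 + r₁₄) * ((1 + r₂₃) * (1 + r₂₄)))| ≤
      |r₁₂| * |r₃₄| * (1 + R) ^ 4 := by
    rw [abs_mul, abs_mul, abs_mul, abs_mul, abs_mul,
      show (1 + R) ^ 4 = (1 + R) * (1 + R) * ((1 + R) * (1 + R)) by ring]
    gcongr <;> exact one_add ‹_›
  have t2 : |r₁₃ * r₂₄ * ((1 + r₁₄) * (1 + r₂₃) * (1 + r₁₂ + r₃₄))| ≤
      |r₁₃| * |r₂₄| * (1 + R) ^ 4 := by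
    rw [abs_mul, abs_mul, abs_mul, abs_mul,
      show (1 + R) ^ 4 = (1 + R) * (1 + R) * ((1 + R) * (1 + R)) by ring]
    gcongr
    exacts [one_add ‹_›, one_add ‹_›, two_add ‹_› ‹_›]
  have t3 : |r₁₄ * r₂₃ * ((1 + r₁₂ + r₃₄) * (1 + r₁₃ + r₂₄))| ≤
      |r₁₄| * |r₂₃| * (1 + R) ^ 4 := by
    rw [abs_mul, abs_mul, abs_mul,
      show (1 + R) ^ 4 = (1 + R) * (1 + R) * ((1 + R) * (1 + R)) by ring]
    gcongr
    exacts [two_add ‹_› ‹_›, two_add ‹_› ‹_›]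
  have star : ∀ {r s t : ℝ}, |t| ≤ R → |t * r * s| ≤ |r| * |s| * (1 + R) ^ 4 := by
    intro r s t h
    rw [abs_mul, abs_mul, mul_comm |t|, mul_right_comm]
    gcongr
    exact h.trans hR4
  have t4 : |r₁₂ * r₁₃ * r₁₄| ≤ |r₁₃| * |r₁₄| * (1 + R) ^ 4 := star h₁₂
  have t5 : |r₁₂ * r₂₃ * r₂₄| ≤ |r₂₃| * |r₂₄| * (1 + R) ^ 4 := star h₁₂
  have t6 : |r₁₃ * r₂₃ * r₃₄| ≤ |r₁₃| * |r₂₃| * (1 + R) ^ 4 := by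
    rw [show r₁₃ * r₂₃ * r₃₄ = r₃₄ * r₁₃ * r₂₃ by ring]; exact star h₃₄
  have t7 : |r₁₄ * r₂₄ * r₃₄| ≤ |r₁₄| * |r₂₄| * (1 + R) ^ 4 := by
    rw [show r₁₄ * r₂₄ * r₃₄ = r₃₄ * r₁₄ * r₂₄ by ring]; exact star h₃₄
  unfold fourPoint
  refine (abs_add_le _ _).trans ((add_le_add ((abs_add_le _ _).trans (add_le_add
    ((abs_add_le _ _).trans (add_le_add ((abs_add_le _ _).trans (add_le_add
    ((abs_add_le _ _).trans (add_le_add ((abs_add_le _ _).trans (add_le_add t1 t2)) t3)) t4))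
    t5)) t6)) t7).trans (le_of_eq ?_))
  ring

variable {Ω : Type*} [MeasurableSpace Ω] {P : Measure Ω} {G : ℝ → Ω → ℝ} {C : ℝ → ℝ}

/-- Centers a single factor of a product; iterating it carries out the inclusion-exclusion from raw
to centered moments. -/
lemma integrable_and_integral_sub_mul {F F₀ F₁ : Ω → ℝ} {v₀ v₁ : ℝ} (m : ℝ)
    (h₁ : Integrable F₁ P ∧ ∫ ω, F₁ ω ∂P = v₁) (h₀ : Integrable F₀ P ∧ ∫ ω, F₀ ω ∂P = v₀)
    (h : ∀ ω, F ω = F₁ ω - m * F₀ ω) :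
    Integrable F P ∧ ∫ ω, F ω ∂P = v₁ - m * v₀ := by
  obtain rfl : F = fun ω => F₁ ω - m * F₀ ω := funext h
  refine ⟨h₁.1.sub (h₀.1.const_mul m), ?_⟩
  rw [integral_sub h₁.1 (h₀.1.const_mul m), integral_const_mul, h₁.2, h₀.2]

namespace IsStationaryGaussianField

lemma integrable_and_integral_fluct_four (hG : IsStationaryGaussianField P G C) (x y z w : ℝ) :
    Integrable (fun ω => fluct G C x ω * fluct G C y ω * (fluct G C z ω * fluct G C w ω)) P ∧
    ∫ ω, fluct G C x ω * fluct G C y ω * (fluct G C z ω * fluct G C w ω) ∂P =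
      Real.exp (C 0) ^ 2 * fourPoint (Real.exp (C (x - y)) - 1) (Real.exp (C (x - z)) - 1)
        (Real.exp (C (x - w)) - 1) (Real.exp (C (y - z)) - 1) (Real.exp (C (y - w)) - 1)
        (Real.exp (C (z - w)) - 1) := by
  set m := Real.exp (C 0 / 2) with hm
  set b : ℝ → Ω → ℝ := fun x ω => Real.exp (-G x ω) with hb
  -- Only exponents `0` and `1` are used; `h1` to `h4` center the factors one by one, starting from
  -- the last.
  have h0 : ∀ i j k l : ℕ, _ ∧ _ := fun i j k l =>
    hG.integrable_prod_pow_and_integral ![x, y, z, w] ![i, j, k, l]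
  simp only [Fin.prod_univ_four, Matrix.cons_val] at h0
  have h1 : ∀ i j k : ℕ, _ ∧ _ := fun i j k => integrable_and_integral_sub_mul
    (F := fun ω => b x ω ^ i * b y ω ^ j * b z ω ^ k * (b w ω - m)) m (h0 i j k 1) (h0 i j k 0)
    fun ω => by simp only [hb]; ring
  have h2 : ∀ i j : ℕ, _ ∧ _ := fun i j => integrable_and_integral_sub_mul
    (F := fun ω => b x ω ^ i * b y ω ^ j * ((b z ω - m) * (b w ω - m))) m (h1 i j 1) (h1 i j 0)
    fun ω => by ring
  have h3 : ∀ i : ℕ, _ ∧ _ := fun i => integrable_and_integral_sub_mul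
    (F := fun ω => b x ω ^ i * (b y ω - m) * ((b z ω - m) * (b w ω - m))) m (h2 i 1) (h2 i 0)
    fun ω => by ring
  have h4 := integrable_and_integral_sub_mul
    (F := fun ω => (b x ω - m) * (b y ω - m) * ((b z ω - m) * (b w ω - m))) m (h3 1) (h3 0)
    fun ω => by ring
  refine ⟨h4.1, h4.2.trans ?_⟩
  have hmm : Real.exp (C 0) = m ^ 2 := by
    rw [hm, ← Real.exp_nat_mul]; congr 1; push_cast; ring
  rw [hmm]
  unfold fourPoint
  ring

lemma integrable_and_integral_fluct_two (hG : IsStationaryGaussianField P G C) (x y : ℝ) :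
    Integrable (fun ω => fluct G C x ω * fluct G C y ω) P ∧
    ∫ ω, fluct G C x ω * fluct G C y ω ∂P = Real.exp (C 0) * (Real.exp (C (x - y)) - 1) := by
  set m := Real.exp (C 0 / 2) with hm
  set b : ℝ → Ω → ℝ := fun x ω => Real.exp (-G x ω) with hb
  have h0 : ∀ i j : ℕ, _ ∧ _ := fun i j =>
    hG.integrable_prod_pow_and_integral ![x, y, 0, 0] ![i, j, 0, 0]
  simp only [Fin.prod_univ_four, Matrix.cons_val] at h0
  have h1 : ∀ i : ℕ, _ ∧ _ := fun i => integrable_and_integral_sub_mul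
    (F := fun ω => b x ω ^ i * (b y ω - m)) m (h0 i 1) (h0 i 0)
    fun ω => by simp only [hb]; ring
  have h2 := integrable_and_integral_sub_mul
    (F := fun ω => (b x ω - m) * (b y ω - m)) m (h1 1) (h1 0) fun ω => by ring
  refine ⟨h2.1, h2.2.trans ?_⟩
  have hmm : Real.exp (C 0) = m ^ 2 := by
    rw [hm, ← Real.exp_nat_mul]; congr 1; push_cast; ring
  rw [hmm]
  ring

lemma integrable_and_integral_exp_neg (hG : IsStationaryGaussianField P G C) (x : ℝ) :
    Integrable (fun ω => Real.exp (-G x ω)) P ∧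
    ∫ ω, Real.exp (-G x ω) ∂P = Real.exp (C 0 / 2) := by
  have h := hG.integrable_prod_pow_and_integral ![x, 0, 0, 0] ![1, 0, 0, 0]
  simpa [Fin.prod_univ_four] using h

lemma covInv_eq (hG : IsStationaryGaussianField P G C) (x : ℝ) :
    covInv P G x = Real.exp (C 0) * (Real.exp (C x) - 1) := by
  have h := (hG.integrable_and_integral_fluct_two x 0).2
  rw [sub_zero] at h
  rw [← h, covInv, covariance]
  have hc : ∀ x ω, 1 / coeff G x ω = Real.exp (-G x ω) := fun x ω => by
    rw [coeff, Real.exp_neg, one_div]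
  simp only [hc, (hG.integrable_and_integral_exp_neg _).2, fluct]

lemma memLp_fluct (hG : IsStationaryGaussianField P G C) (x : ℝ) : MemLp (fluct G C x) 2 P := by
  have hm : AEStronglyMeasurable (fluct G C x) P := by
    have := hG.gaussian.aemeasurable x
    exact (this.neg.exp.sub_const _).aestronglyMeasurable
  rw [memLp_two_iff_integrable_sq hm]
  simpa only [sq] using (hG.integrable_and_integral_fluct_two x x).1

lemma memLp_fluct_mul (hG : IsStationaryGaussianField P G C) (x y : ℝ) :
    MemLp (fun ω => fluct G C x ω * fluct G C y ω) 2 P := by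
  refine (memLp_two_iff_integrable_sq
    ((hG.memLp_fluct x).aestronglyMeasurable.mul (hG.memLp_fluct y).aestronglyMeasurable)).2 ?_
  simpa only [sq, Pi.mul_apply] using (hG.integrable_and_integral_fluct_four x y x y).1

end IsStationaryGaussianField

lemma measurable_uncurry_fluct (hGc : ∀ ω, Continuous fun x => G x ω)
    (hGm : ∀ x, Measurable (G x)) : Measurable (Function.uncurry (fluct G C)) := by
  have := measurable_uncurry_of_continuous_of_measurable hGc hGm
  exact (Real.measurable_exp.comp this.neg).sub_const _

end FluctuationMoments

/-! ### Second and fourth moments of the integrated fluctuation. -/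

section FluctuationIntegral

/-- Lebesgue measure on the unit interval. -/
noncomputable abbrev unitVolume : Measure ℝ := volume.restrict (Ioc (0 : ℝ) 1)

/-- The fluctuation of `1 / a (· / ε)` tested against `h` on the unit interval. -/
noncomputable def fluctIntegral {Ω : Type*} (G : ℝ → Ω → ℝ) (C : ℝ → ℝ) (ε : ℝ) (h : ℝ → ℝ)
    (ω : Ω) : ℝ :=
  ∫ x, fluct G C (x / ε) ω * h x ∂unitVolume

lemma fluctIntegral_sq_eq {Ω : Type*} (G : ℝ → Ω → ℝ) (C : ℝ → ℝ) (ε : ℝ) (h : ℝ → ℝ) (ω : Ω) :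
    fluctIntegral G C ε h ω ^ 2 = ∫ p : ℝ × ℝ, (fluct G C (p.1 / ε) ω * h p.1) *
      (fluct G C (p.2 / ε) ω * h p.2) ∂(unitVolume.prod unitVolume) := by
  rw [integral_prod_mul (fun x => fluct G C (x / ε) ω * h x)
    (fun x => fluct G C (x / ε) ω * h x), sq, fluctIntegral]

variable {Ω : Type*} [MeasurableSpace Ω] {P : Measure Ω} {G : ℝ → Ω → ℝ} {C : ℝ → ℝ}
  {h : ℝ → ℝ} {ε H R : ℝ}

namespace IsStationaryGaussianField

/-- No regularity of `C` is assumed; joint measurability of the field supplies it through `C x = E[G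
x * G 0]`. -/
lemma measurable_cov [SFinite P] (hG : IsStationaryGaussianField P G C)
    (hGc : ∀ ω, Continuous fun x => G x ω) (hGm : ∀ x, Measurable (G x)) : Measurable C := by
  have hu := measurable_uncurry_of_continuous_of_measurable hGc hGm
  have h1 : Measurable fun q : ℝ × Ω => G q.1 q.2 * G 0 q.2 :=
    hu.mul ((hGm 0).comp measurable_snd)
  have h2 := h1.stronglyMeasurable.integral_prod_right' (ν := P)
  have h3 : (fun x => ∫ ω, G x ω * G 0 ω ∂P) = C := by
    ext x
    rw [hG.integral_mul, sub_zero]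
  exact h3 ▸ h2.measurable

lemma memLp_fluct_mul_const (hG : IsStationaryGaussianField P G C) (x : ℝ) :
    MemLp (fun ω => fluct G C (x / ε) ω * h x) 2 P := by
  simpa only [mul_comm] using (hG.memLp_fluct (x / ε)).const_mul (h x)

lemma measurable_uncurry_fluct_mul (hGc : ∀ ω, Continuous fun x => G x ω)
    (hGm : ∀ x, Measurable (G x)) (hh : Measurable h) :
    Measurable (Function.uncurry fun x ω => fluct G C (x / ε) ω * h x) :=
  ((measurable_uncurry_fluct hGc hGm).comp
    ((measurable_fst.div_const ε).prodMk measurable_snd)).mul (hh.comp measurable_fst)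

lemma integral_sq_fluct_mul_le (hG : IsStationaryGaussianField P G C) (hH : ∀ x, |h x| ≤ H)
    (x : ℝ) :
    ∫ ω, (fluct G C (x / ε) ω * h x) ^ 2 ∂P ≤
      Real.exp (C 0) * |Real.exp (C 0) - 1| * H ^ 2 := by
  have h2 := (hG.integrable_and_integral_fluct_two (x / ε) (x / ε)).2
  rw [sub_self] at h2
  have : ∫ ω, (fluct G C (x / ε) ω * h x) ^ 2 ∂P =
      Real.exp (C 0) * (Real.exp (C 0) - 1) * h x ^ 2 := by
    rw [← h2, ← integral_mul_const]
    congr 1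
    ext ω
    ring
  rw [this]
  refine mul_le_mul (mul_le_mul_of_nonneg_left (le_abs_self _) (Real.exp_pos _).le) ?_
    (sq_nonneg _) (by positivity)
  exact sq_le_sq' (by linarith [abs_le.1 (hH x)]) (abs_le.1 (hH x)).2

lemma abs_integral_fluct_four_le (hG : IsStationaryGaussianField P G C)
    (hR : ∀ z, |Real.exp (C z) - 1| ≤ R) (x y z w : ℝ) :
    |∫ ω, fluct G C x ω * fluct G C y ω * (fluct G C z ω * fluct G C w ω) ∂P| ≤
      Real.exp (C 0) ^ 2 * (1 + R) ^ 4 *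
      (|Real.exp (C (x - y)) - 1| * |Real.exp (C (z - w)) - 1| +
       |Real.exp (C (x - z)) - 1| * |Real.exp (C (y - w)) - 1| +
       |Real.exp (C (x - w)) - 1| * |Real.exp (C (y - z)) - 1| +
       |Real.exp (C (x - z)) - 1| * |Real.exp (C (x - w)) - 1| +
       |Real.exp (C (y - z)) - 1| * |Real.exp (C (y - w)) - 1| +
       |Real.exp (C (x - z)) - 1| * |Real.exp (C (y - z)) - 1| +
       |Real.exp (C (x - w)) - 1| * |Real.exp (C (y - w)) - 1|) := by
  rw [(hG.integrable_and_integral_fluct_four x y z w).2, abs_mul, mul_assoc,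
    abs_of_nonneg (sq_nonneg (Real.exp (C 0)))]
  exact mul_le_mul_of_nonneg_left
    (abs_fourPoint_le (hR _) (hR _) (hR _) (hR _) (hR _) (hR _)) (sq_nonneg _)

variable [IsProbabilityMeasure P]

lemma memLp_fluctIntegral (hG : IsStationaryGaussianField P G C)
    (hGc : ∀ ω, Continuous fun x => G x ω) (hGm : ∀ x, Measurable (G x)) (hh : Measurable h)
    (hH : ∀ x, |h x| ≤ H) : MemLp (fluctIntegral G C ε h) 2 P :=
  memLp_two_integral (measurable_uncurry_fluct_mul hGc hGm hh)
    (fun x => hG.memLp_fluct_mul_const x) (hG.integral_sq_fluct_mul_le hH)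

lemma integral_fluctIntegral_sq (hG : IsStationaryGaussianField P G C)
    (hGc : ∀ ω, Continuous fun x => G x ω) (hGm : ∀ x, Measurable (G x)) (hh : Measurable h)
    (hH : ∀ x, |h x| ≤ H) :
    ∫ ω, fluctIntegral G C ε h ω ^ 2 ∂P =
      Real.exp (C 0) * ∫ p, h p.1 * h p.2 * (Real.exp (C ((p.1 - p.2) / ε)) - 1)
        ∂(unitVolume.prod unitVolume) := by
  have := integral_integral_sq (P := P) (μ := unitVolume)
    (measurable_uncurry_fluct_mul (ε := ε) (C := C) hGc hGm hh)
    (fun x => hG.memLp_fluct_mul_const x) (hG.integral_sq_fluct_mul_le hH)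
  refine this.trans ?_
  rw [← integral_const_mul]
  congr 1
  ext p
  rw [show (p.1 - p.2) / ε = p.1 / ε - p.2 / ε by ring, ← mul_left_comm,
    ← (hG.integrable_and_integral_fluct_two (p.1 / ε) (p.2 / ε)).2, ← integral_const_mul]
  congr 1
  ext ω
  ring

end IsStationaryGaussianField

lemma integral_unitVolume_comp_sub_div_le {r : ℝ → ℝ} (hr0 : ∀ z, 0 ≤ r z) (hr : Integrable r)
    (hε : 0 < ε) (x : ℝ) : ∫ y, r ((x - y) / ε) ∂unitVolume ≤ ε * ∫ z, r z := by
  rw [← integral_comp_sub_div r hε x]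
  exact setIntegral_le_integral ((hr.comp_div hε.ne').comp_sub_left x)
    (Filter.Eventually.of_forall fun y => hr0 _)

lemma integrable_and_integral_prod_comp_sub_div_le {r : ℝ → ℝ} (hrm : Measurable r)
    (hr0 : ∀ z, 0 ≤ r z) (hrR : ∀ z, r z ≤ R) (hr : Integrable r) (hε : 0 < ε) :
    Integrable (fun p : ℝ × ℝ => r ((p.1 - p.2) / ε)) (unitVolume.prod unitVolume) ∧
    ∫ p : ℝ × ℝ, r ((p.1 - p.2) / ε) ∂(unitVolume.prod unitVolume) ≤ ε * ∫ z, r z := by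
  have hi : Integrable (fun p : ℝ × ℝ => r ((p.1 - p.2) / ε)) (unitVolume.prod unitVolume) := by
    refine Integrable.of_bound (C := R)
      (hrm.comp ((measurable_fst.sub measurable_snd).div_const ε)).aestronglyMeasurable
      (Filter.Eventually.of_forall fun q => ?_)
    rw [Real.norm_of_nonneg (hr0 _)]
    exact hrR _
  refine ⟨hi, ?_⟩
  rw [integral_prod _ hi]
  calc ∫ x, ∫ y, r ((x - y) / ε) ∂unitVolume ∂unitVolume
      ≤ ∫ _, (ε * ∫ z, r z) ∂unitVolume :=
        integral_mono hi.integral_prod_left (integrable_const _)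
          (integral_unitVolume_comp_sub_div_le hr0 hr hε)
    _ = ε * ∫ z, r z := by simp

/-- The seven pairings that dominate the four-point function, integrated over the unit cube. -/
lemma integral_pairings_le {r : ℝ → ℝ} (hrm : Measurable r) (hr0 : ∀ z, 0 ≤ r z)
    (hrR : ∀ z, r z ≤ R) (hreven : ∀ z, r (-z) = r z) (hr : Integrable r) (hε : 0 < ε) :
    Integrable (fun q : (ℝ × ℝ) × (ℝ × ℝ) =>
      r ((q.1.1 - q.1.2) / ε) * r ((q.2.1 - q.2.2) / ε) +
      r ((q.1.1 - q.2.1) / ε) * r ((q.1.2 - q.2.2) / ε) +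
      r ((q.1.1 - q.2.2) / ε) * r ((q.1.2 - q.2.1) / ε) +
      r ((q.1.1 - q.2.1) / ε) * r ((q.1.1 - q.2.2) / ε) +
      r ((q.1.2 - q.2.1) / ε) * r ((q.1.2 - q.2.2) / ε) +
      r ((q.1.1 - q.2.1) / ε) * r ((q.1.2 - q.2.1) / ε) +
      r ((q.1.1 - q.2.2) / ε) * r ((q.1.2 - q.2.2) / ε))
      ((unitVolume.prod unitVolume).prod (unitVolume.prod unitVolume)) ∧
    ∫ q : (ℝ × ℝ) × (ℝ × ℝ),
      (r ((q.1.1 - q.1.2) / ε) * r ((q.2.1 - q.2.2) / ε) +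
      r ((q.1.1 - q.2.1) / ε) * r ((q.1.2 - q.2.2) / ε) +
      r ((q.1.1 - q.2.2) / ε) * r ((q.1.2 - q.2.1) / ε) +
      r ((q.1.1 - q.2.1) / ε) * r ((q.1.1 - q.2.2) / ε) +
      r ((q.1.2 - q.2.1) / ε) * r ((q.1.2 - q.2.2) / ε) +
      r ((q.1.1 - q.2.1) / ε) * r ((q.1.2 - q.2.1) / ε) +
      r ((q.1.1 - q.2.2) / ε) * r ((q.1.2 - q.2.2) / ε))
      ∂((unitVolume.prod unitVolume).prod (unitVolume.prod unitVolume)) ≤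
      7 * (ε * ∫ z, r z) ^ 2 := by
  have hprob : IsProbabilityMeasure unitVolume := ⟨by simp [unitVolume]⟩
  have hR0 : 0 ≤ R := (hr0 0).trans (hrR 0)
  set ν := unitVolume.prod unitVolume with hν
  set L := ε * ∫ z, r z with hL
  have hL0 : 0 ≤ L := mul_nonneg hε.le (integral_nonneg hr0)
  have hone : ∀ x, ∫ y, r ((x - y) / ε) ∂unitVolume ≤ L :=
    integral_unitVolume_comp_sub_div_le hr0 hr hε
  have hone0 : ∀ x, 0 ≤ ∫ y, r ((x - y) / ε) ∂unitVolume := fun x => integral_nonneg fun y => hr0 _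
  have hsymm : ∀ x y, r ((x - y) / ε) = r ((y - x) / ε) := fun x y => by
    rw [← hreven]; congr 1; ring
  have hint : ∀ {α : Type} [MeasurableSpace α] (κ : Measure α) [IsFiniteMeasure κ] {s t : α → ℝ},
      Measurable s → Measurable t → Integrable (fun q => r (s q) * r (t q)) κ := by
    intro α _ κ _ s t hs ht
    refine Integrable.of_bound (C := R * R) (by fun_prop) (Filter.Eventually.of_forall fun q => ?_)
    rw [Real.norm_of_nonneg (mul_nonneg (hr0 _) (hr0 _))]
    exact mul_le_mul (hrR _) (hrR _) (hr0 _) hR0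
  have hbd : ∀ {α : Type} [MeasurableSpace α] (κ : Measure α) [IsProbabilityMeasure κ]
      {F : α → ℝ}, (∀ p, F p ≤ L ^ 2) → Integrable F κ → ∫ p, F p ∂κ ≤ L ^ 2 := by
    intro α _ κ _ F hF hFi
    calc ∫ p, F p ∂κ ≤ ∫ _, L ^ 2 ∂κ := integral_mono hFi (integrable_const _) hF
      _ = L ^ 2 := by simp
  have hpair : ∀ a b, ∫ p : ℝ × ℝ, r ((a - p.1) / ε) * r ((b - p.2) / ε) ∂ν ≤ L ^ 2 := by
    intro a b
    rw [hν, integral_prod_mul (fun y => r ((a - y) / ε)) (fun y => r ((b - y) / ε)), sq]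
    exact mul_le_mul (hone a) (hone b) (hone0 b) hL0
  have hfix : ∀ {F : (ℝ × ℝ) × (ℝ × ℝ) → ℝ}, Integrable F (ν.prod ν) →
      (∀ p, ∫ q, F (p, q) ∂ν ≤ L ^ 2) → ∫ q, F q ∂(ν.prod ν) ≤ L ^ 2 := by
    intro F hF hle
    rw [integral_prod _ hF]
    exact hbd ν hle hF.integral_prod_left
  have hfix' : ∀ {F : (ℝ × ℝ) × (ℝ × ℝ) → ℝ}, Integrable F (ν.prod ν) →
      (∀ q, ∫ p, F (p, q) ∂ν ≤ L ^ 2) → ∫ q, F q ∂(ν.prod ν) ≤ L ^ 2 := by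
    intro F hF hle
    rw [integral_prod_symm _ hF]
    exact hbd ν hle hF.integral_prod_right
  have i1 : Integrable (fun q : (ℝ × ℝ) × (ℝ × ℝ) =>
      r ((q.1.1 - q.1.2) / ε) * r ((q.2.1 - q.2.2) / ε)) (ν.prod ν) :=
    hint _ (by fun_prop) (by fun_prop)
  have i2 : Integrable (fun q : (ℝ × ℝ) × (ℝ × ℝ) =>
      r ((q.1.1 - q.2.1) / ε) * r ((q.1.2 - q.2.2) / ε)) (ν.prod ν) :=
    hint _ (by fun_prop) (by fun_prop)
  have i3 : Integrable (fun q : (ℝ × ℝ) × (ℝ × ℝ) =>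
      r ((q.1.1 - q.2.2) / ε) * r ((q.1.2 - q.2.1) / ε)) (ν.prod ν) :=
    hint _ (by fun_prop) (by fun_prop)
  have i4 : Integrable (fun q : (ℝ × ℝ) × (ℝ × ℝ) =>
      r ((q.1.1 - q.2.1) / ε) * r ((q.1.1 - q.2.2) / ε)) (ν.prod ν) :=
    hint _ (by fun_prop) (by fun_prop)
  have i5 : Integrable (fun q : (ℝ × ℝ) × (ℝ × ℝ) =>
      r ((q.1.2 - q.2.1) / ε) * r ((q.1.2 - q.2.2) / ε)) (ν.prod ν) :=
    hint _ (by fun_prop) (by fun_prop)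
  have i6 : Integrable (fun q : (ℝ × ℝ) × (ℝ × ℝ) =>
      r ((q.1.1 - q.2.1) / ε) * r ((q.1.2 - q.2.1) / ε)) (ν.prod ν) :=
    hint _ (by fun_prop) (by fun_prop)
  have i7 : Integrable (fun q : (ℝ × ℝ) × (ℝ × ℝ) =>
      r ((q.1.1 - q.2.2) / ε) * r ((q.1.2 - q.2.2) / ε)) (ν.prod ν) :=
    hint _ (by fun_prop) (by fun_prop)
  -- This pairing factors over the two pairs; the others need one pair frozen.
  have b1 : ∫ q : (ℝ × ℝ) × (ℝ × ℝ), r ((q.1.1 - q.1.2) / ε) * r ((q.2.1 - q.2.2) / ε)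
      ∂(ν.prod ν) ≤ L ^ 2 := by
    have hle : ∫ p : ℝ × ℝ, r ((p.1 - p.2) / ε) ∂ν ≤ L :=
      (integrable_and_integral_prod_comp_sub_div_le hrm hr0 hrR hr hε).2
    rw [integral_prod_mul (fun p : ℝ × ℝ => r ((p.1 - p.2) / ε))
      (fun p : ℝ × ℝ => r ((p.1 - p.2) / ε)), sq]
    exact mul_le_mul hle hle (integral_nonneg fun _ => hr0 _) hL0
  have b2 := hfix i2 fun p => hpair p.1 p.2
  have b3 := hfix i3 fun p => by simpa only [mul_comm] using hpair p.2 p.1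
  have b4 := hfix i4 fun p => hpair p.1 p.1
  have b5 := hfix i5 fun p => hpair p.2 p.2
  -- Here both correlations share a point of the second pair, so the second pair is frozen; evenness
  -- of `r` puts the differences in the form of `hpair`.
  have b6 := hfix' i6 fun q => by
    simpa only [hsymm q.1] using hpair q.1 q.1
  have b7 := hfix' i7 fun q => by
    simpa only [hsymm q.2] using hpair q.2 q.2
  have hadd : ∀ {F F' : (ℝ × ℝ) × (ℝ × ℝ) → ℝ} {v v' : ℝ},
      (Integrable F (ν.prod ν) ∧ ∫ q, F q ∂(ν.prod ν) ≤ v) →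
      (Integrable F' (ν.prod ν) ∧ ∫ q, F' q ∂(ν.prod ν) ≤ v') →
      Integrable (fun q => F q + F' q) (ν.prod ν) ∧ ∫ q, (F q + F' q) ∂(ν.prod ν) ≤ v + v' :=
    fun h h' => ⟨h.1.add h'.1, by rw [integral_add h.1 h'.1]; exact add_le_add h.2 h'.2⟩
  have htot := hadd (hadd (hadd (hadd (hadd (hadd ⟨i1, b1⟩ ⟨i2, b2⟩) ⟨i3, b3⟩) ⟨i4, b4⟩)
    ⟨i5, b5⟩) ⟨i6, b6⟩) ⟨i7, b7⟩
  exact ⟨htot.1, htot.2.trans (le_of_eq (by ring))⟩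

namespace IsStationaryGaussianField

variable [IsProbabilityMeasure P]

/-- The square of the fluctuation integral is itself a parameter integral, over pairs of points. The
second-moment lemmas thus apply to it and reduce its fourth moment to the integrated four-point
function. -/
lemma memLp_fluctIntegral_sq_and_integral_le (hG : IsStationaryGaussianField P G C)
    (hGc : ∀ ω, Continuous fun x => G x ω) (hGm : ∀ x, Measurable (G x)) (hh : Measurable h)
    (hH : ∀ x, |h x| ≤ H) (hR : ∀ z, |Real.exp (C z) - 1| ≤ R)
    (hC : Integrable fun z => Real.exp (C z) - 1) (hε : 0 < ε) :
    MemLp (fun ω => fluctIntegral G C ε h ω ^ 2) 2 P ∧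
    ∫ ω, (fluctIntegral G C ε h ω ^ 2) ^ 2 ∂P ≤
      Real.exp (C 0) ^ 2 * (1 + R) ^ 4 * (7 * (∫ z, |Real.exp (C z) - 1|) ^ 2) *
        H ^ 4 * ε ^ 2 := by
  have hR0 : 0 ≤ R := (abs_nonneg _).trans (hR 0)
  have hH0 : 0 ≤ H := (abs_nonneg _).trans (hH 0)
  set Z : ℝ × ℝ → Ω → ℝ := fun p ω =>
    (fluct G C (p.1 / ε) ω * h p.1) * (fluct G C (p.2 / ε) ω * h p.2) with hZ
  have hZm : Measurable (Function.uncurry Z) := by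
    have h0 := measurable_uncurry_fluct_mul (ε := ε) (C := C) hGc hGm hh
    exact (h0.comp ((measurable_fst.comp measurable_fst).prodMk measurable_snd)).mul
      (h0.comp ((measurable_snd.comp measurable_fst).prodMk measurable_snd))
  have hZ2 : ∀ p, MemLp (Z p) 2 P := fun p => by
    have := (hG.memLp_fluct_mul (p.1 / ε) (p.2 / ε)).const_mul (h p.1 * h p.2)
    convert! this using 2
    simp only [hZ]
    ring
  have hcov : ∀ p q, ∫ ω, Z p ω * Z q ω ∂P = (h p.1 * h p.2 * (h q.1 * h q.2)) *
      ∫ ω, fluct G C (p.1 / ε) ω * fluct G C (p.2 / ε) ω *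
        (fluct G C (q.1 / ε) ω * fluct G C (q.2 / ε) ω) ∂P := fun p q => by
    rw [← integral_const_mul]
    congr 1
    ext ω
    simp only [hZ]
    ring
  have hh4 : ∀ p q : ℝ × ℝ, |h p.1 * h p.2 * (h q.1 * h q.2)| ≤ H ^ 4 := fun p q => by
    rw [abs_mul, abs_mul, abs_mul, show H ^ 4 = H * H * (H * H) by ring]
    gcongr <;> exact hH _
  set A := Real.exp (C 0) ^ 2 * (1 + R) ^ 4 with hA
  have hA0 : 0 ≤ A := by positivity
  -- A crude bound without any `ε`, serving only to license Fubini.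
  have hM : ∀ p, ∫ ω, Z p ω ^ 2 ∂P ≤ H ^ 4 * (A * (7 * (R * R))) := fun p => by
    simp only [sq (Z p _)]
    refine (le_abs_self _).trans ?_
    rw [hcov, abs_mul]
    refine mul_le_mul (hh4 p p) ((hG.abs_integral_fluct_four_le hR _ _ _ _).trans ?_)
      (abs_nonneg _) (by positivity)
    refine mul_le_mul_of_nonneg_left ?_ hA0
    have hRR : ∀ z w, |Real.exp (C z) - 1| * |Real.exp (C w) - 1| ≤ R * R := fun z w =>
      mul_le_mul (hR z) (hR w) (abs_nonneg _) hR0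
    linarith [hRR (p.1 / ε - p.2 / ε) (p.1 / ε - p.2 / ε),
      hRR (p.1 / ε - p.1 / ε) (p.2 / ε - p.2 / ε), hRR (p.1 / ε - p.2 / ε) (p.2 / ε - p.1 / ε),
      hRR (p.1 / ε - p.1 / ε) (p.1 / ε - p.2 / ε), hRR (p.2 / ε - p.1 / ε) (p.2 / ε - p.2 / ε),
      hRR (p.1 / ε - p.1 / ε) (p.2 / ε - p.1 / ε), hRR (p.1 / ε - p.2 / ε) (p.2 / ε - p.2 / ε)]
  have hXeq : (fun ω => fluctIntegral G C ε h ω ^ 2) =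
      fun ω => ∫ p, Z p ω ∂(unitVolume.prod unitVolume) :=
    funext fun ω => fluctIntegral_sq_eq G C ε h ω
  refine ⟨by rw [hXeq]; exact memLp_two_integral hZm hZ2 hM, ?_⟩
  have hCm := hG.measurable_cov hGc hGm
  obtain ⟨hpi, hple⟩ := integral_pairings_le (r := fun z => |Real.exp (C z) - 1|) (R := R)
    (by fun_prop) (fun _ => abs_nonneg _) hR (fun z => by rw [hG.even]) hC.abs hε
  have hsq : ∫ ω, (fluctIntegral G C ε h ω ^ 2) ^ 2 ∂P =
      ∫ q, ∫ ω, Z q.1 ω * Z q.2 ω ∂P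
        ∂((unitVolume.prod unitVolume).prod (unitVolume.prod unitVolume)) := by
    rw [← integral_integral_sq hZm hZ2 hM]
    exact integral_congr_ae (Filter.Eventually.of_forall fun ω => by
      simp only [fluctIntegral_sq_eq, hZ])
  rw [hsq]
  refine (integral_mono (integrable_integral_mul hZm hZ2 hM) (hpi.const_mul (H ^ 4 * A))
    fun q => ?_).trans ?_
  · simp only [sub_div]
    refine (le_abs_self _).trans ?_
    rw [hcov, abs_mul, mul_assoc (H ^ 4)]
    exact mul_le_mul (hh4 q.1 q.2) (hG.abs_integral_fluct_four_le hR _ _ _ _)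
      (abs_nonneg _) (by positivity)
  · rw [integral_const_mul]
    refine (mul_le_mul_of_nonneg_left hple (by positivity)).trans (le_of_eq ?_)
    ring

end IsStationaryGaussianField

end FluctuationIntegral

/-! ### Positivity of the limiting constant and variance of the linear term. -/

section LimitingVariance

open Filter Topology

variable {Ω : Type*} [MeasurableSpace Ω] {P : Measure Ω} {G : ℝ → Ω → ℝ} {C : ℝ → ℝ}
  {A B b ε H R : ℝ} {h : ℝ → ℝ}

lemma abs_exp_sub_one_le_mul_exp (t : ℝ) : |Real.exp t - 1| ≤ |t| * Real.exp |t| := by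
  rcases le_total 0 t with ht | ht
  · rw [abs_of_nonneg ht, abs_of_nonneg (by linarith [Real.one_le_exp ht])]
    have h1 := Real.one_sub_le_exp_neg t
    have h2 : Real.exp t * Real.exp (-t) = 1 := by rw [← Real.exp_add]; simp
    nlinarith [Real.exp_pos t]
  · rw [abs_of_nonpos ht, abs_of_nonpos (by linarith [Real.exp_le_one_iff.2 ht])]
    nlinarith [Real.add_one_le_exp t, Real.one_le_exp (neg_nonneg.2 ht)]

lemma decay_mono {β : ℝ} (hbβ : b ≤ β) (hdecay : ∀ z, |C z| ≤ A * (1 + |z|) ^ (-β)) (z : ℝ) :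
    |C z| ≤ A * (1 + |z|) ^ (-b) :=
  (hdecay z).trans (mul_le_mul_of_nonneg_left
    (Real.rpow_le_rpow_of_exponent_le (by linarith [abs_nonneg z]) (by linarith))
    (decay_const_nonneg hdecay))

lemma decay_le_const (hb : 0 ≤ b) (hdecay : ∀ z, |C z| ≤ A * (1 + |z|) ^ (-b)) (z : ℝ) :
    |C z| ≤ A := by
  refine (hdecay z).trans (mul_le_of_le_one_right (decay_const_nonneg hdecay) ?_)
  exact Real.rpow_le_one_of_one_le_of_nonpos (by linarith [abs_nonneg z]) (by linarith)

lemma decay_exp_sub_one (hb : 0 ≤ b) (hdecay : ∀ z, |C z| ≤ A * (1 + |z|) ^ (-b)) (z : ℝ) :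
    |Real.exp (C z) - 1| ≤ (A * Real.exp A) * (1 + |z|) ^ (-b) := by
  have hA := decay_const_nonneg hdecay
  refine (abs_exp_sub_one_le_mul_exp _).trans ?_
  rw [mul_right_comm]
  exact mul_le_mul (hdecay z) (Real.exp_le_exp.2 (decay_le_const hb hdecay z))
    (Real.exp_pos _).le (by positivity)

namespace IsStationaryGaussianField

lemma limQ_eq (hG : IsStationaryGaussianField P G C) :
    limQ P G = Real.exp (C 0) * ∫ x, (Real.exp (C x) - 1) := by
  simp only [limQ, hG.covInv_eq, integral_const_mul]

variable [IsProbabilityMeasure P]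

/-- The second moment of `∫ G(x/ε) dx` over the unit interval is `ε ∫ C + O(ε ^ b)` with `b > 1`;
divide by `ε` and let `ε → 0`. -/
lemma integral_cov_nonneg (hG : IsStationaryGaussianField P G C)
    (hGc : ∀ ω, Continuous fun x => G x ω) (hGm : ∀ x, Measurable (G x))
    (hb : 1 < b) (hb' : b < 2) (hdecay : ∀ z, |C z| ≤ A * (1 + |z|) ^ (-b)) :
    0 ≤ ∫ z, C z := by
  obtain ⟨K, -, hK⟩ := exists_kernel_concentration hb hb'
  have hCm := hG.measurable_cov hGc hGm
  have hbound : ∀ ε : ℝ, 0 < ε → -(K * A * ε ^ (b - 1)) ≤ ∫ z, C z := by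
    intro ε hε
    have h1 := hK C (fun _ => 1) A 1 ε hCm measurable_const hε hdecay (by simp) (by simp)
    have hZm : Measurable (Function.uncurry fun x ω => G (x / ε) ω) :=
      (measurable_uncurry_of_continuous_of_measurable hGc hGm).comp
        ((measurable_fst.div_const ε).prodMk measurable_snd)
    have h2 := integral_integral_sq (P := P) (μ := unitVolume) (M := C 0) hZm
      (fun x => hG.memLp (x / ε)) (fun x => by
        simp only [sq]
        rw [hG.integral_mul, sub_self])
    have h3 : 0 ≤ ∫ p : ℝ × ℝ, C ((p.1 - p.2) / ε) ∂(unitVolume.prod unitVolume) := by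
      have : 0 ≤ ∫ ω, (∫ x, G (x / ε) ω ∂unitVolume) ^ 2 ∂P := integral_nonneg fun _ => sq_nonneg _
      rw [h2] at this
      simpa only [hG.integral_mul, ← sub_div] using this
    simp only [one_mul, one_pow, mul_one, integral_const, smul_eq_mul,
      measureReal_restrict_apply_univ, Real.volume_real_Ioc, sub_zero] at h1
    rw [max_eq_left zero_le_one, mul_one] at h1
    have h4 := (abs_le.1 h1).2
    have h5 : ε ^ b = ε ^ (b - 1) * ε := by
      rw [← Real.rpow_add_one hε.ne', sub_add_cancel]
    rw [h5] at h4
    have h6 : 0 ≤ ε * ((∫ z, C z) + K * A * ε ^ (b - 1)) := by nlinarith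
    have := nonneg_of_mul_nonneg_right h6 hε
    linarith
  have hlim : Tendsto (fun ε : ℝ => -(K * A * ε ^ (b - 1))) (𝓝[>] 0) (𝓝 0) := by
    have h0 : Tendsto (fun ε : ℝ => ε ^ (b - 1)) (𝓝 0) (𝓝 0) := by
      have := (Real.continuousAt_rpow_const 0 (b - 1) (Or.inr (by linarith))).tendsto
      rwa [Real.zero_rpow (by linarith)] at this
    simpa using ((h0.mono_left nhdsWithin_le_nhds).const_mul (K * A)).neg
  exact le_of_tendsto hlim (eventually_mem_nhdsWithin.mono fun ε hε => hbound ε hε)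

/-- Split off `∫ C ≥ 0`. The remaining integrand `exp C - 1 - C` is nonnegative, and positive near
the origin because `C` stays positive there. -/
lemma integral_exp_cov_sub_one_pos (hG : IsStationaryGaussianField P G C)
    (hGc : ∀ ω, Continuous fun x => G x ω) (hGm : ∀ x, Measurable (G x))
    (hb : 1 < b) (hb' : b < 2) (hdecay : ∀ z, |C z| ≤ A * (1 + |z|) ^ (-b)) (hC0 : 0 < C 0) :
    0 < ∫ z, (Real.exp (C z) - 1) := by
  have hCm := hG.measurable_cov hGc hGm
  have hCi := integrable_of_decay hCm hb hdecay
  have hei : Integrable fun z => Real.exp (C z) - 1 := integrable_of_decay (by fun_prop) hb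
    (decay_exp_sub_one (by linarith) hdecay)
  have hdi : Integrable fun z => Real.exp (C z) - 1 - C z := hei.sub hCi
  have hsplit : ∫ z, (Real.exp (C z) - 1) = (∫ z, C z) + ∫ z, (Real.exp (C z) - 1 - C z) := by
    rw [← integral_add hCi hdi]
    congr 1
    ext z
    ring
  have hpos : 0 < ∫ z, (Real.exp (C z) - 1 - C z) := by
    rw [integral_pos_iff_support_of_nonneg (fun z => by
      simp only [Pi.zero_apply]; linarith [Real.add_one_le_exp (C z)]) hdi]
    have hnear := (hG.tendsto_cov_zero (Eventually.of_forall hGc)).eventually (lt_mem_nhds hC0)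
    refine Measure.measure_pos_of_mem_nhds volume (x := 0) (mem_of_superset hnear fun z hz => ?_)
    have := Real.add_one_lt_exp (ne_of_gt hz)
    simp only [Function.mem_support]
    linarith
  linarith [hG.integral_cov_nonneg hGc hGm hb hb' hdecay]

lemma integral_fluctIntegral (hG : IsStationaryGaussianField P G C)
    (hGc : ∀ ω, Continuous fun x => G x ω) (hGm : ∀ x, Measurable (G x)) (hh : Measurable h)
    (hH : ∀ x, |h x| ≤ H) : ∫ ω, fluctIntegral G C ε h ω ∂P = 0 := by
  have hZm := measurable_uncurry_fluct_mul (ε := ε) (C := C) hGc hGm hh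
  have hZ2 : ∀ x, MemLp (fun ω => fluct G C (x / ε) ω * h x) 2 P := hG.memLp_fluct_mul_const
  have hint : Integrable (Function.uncurry fun x ω => fluct G C (x / ε) ω * h x)
      (unitVolume.prod P) := by
    rw [integrable_prod_iff hZm.aestronglyMeasurable]
    refine ⟨Eventually.of_forall fun x => (hZ2 x).integrable one_le_two, ?_⟩
    refine Integrable.of_bound (C := 1 + Real.exp (C 0) * |Real.exp (C 0) - 1| * H ^ 2)
      (hZm.norm.stronglyMeasurable.integral_prod_right').aestronglyMeasurable
      (Eventually.of_forall fun x => ?_)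
    rw [Real.norm_of_nonneg (integral_nonneg fun _ => norm_nonneg _)]
    calc ∫ ω, ‖fluct G C (x / ε) ω * h x‖ ∂P
        ≤ ∫ ω, (1 + (fluct G C (x / ε) ω * h x) ^ 2) ∂P := by
          refine integral_mono ((hZ2 x).integrable one_le_two).norm
            ((integrable_const _).add (hZ2 x).integrable_sq) fun ω => ?_
          simp only [Real.norm_eq_abs]
          nlinarith [sq_nonneg (|fluct G C (x / ε) ω * h x| - 1),
            sq_abs (fluct G C (x / ε) ω * h x), abs_nonneg (fluct G C (x / ε) ω * h x)]
      _ ≤ _ := by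
          rw [integral_add (integrable_const _) (hZ2 x).integrable_sq]
          simpa using hG.integral_sq_fluct_mul_le hH x
  unfold fluctIntegral
  rw [← integral_integral_swap hint]
  have hzero : ∀ x, ∫ ω, fluct G C x ω ∂P = 0 := fun x => by
    unfold fluct
    rw [integral_sub (hG.integrable_and_integral_exp_neg x).1 (integrable_const _),
      (hG.integrable_and_integral_exp_neg x).2]
    simp
  simp only [integral_mul_const, hzero, zero_mul, integral_zero]

lemma variance_fluctIntegral (hG : IsStationaryGaussianField P G C)
    (hGc : ∀ ω, Continuous fun x => G x ω) (hGm : ∀ x, Measurable (G x)) (hh : Measurable h)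
    (hH : ∀ x, |h x| ≤ H) :
    Var[fluctIntegral G C ε h; P] = ∫ ω, fluctIntegral G C ε h ω ^ 2 ∂P :=
  variance_of_integral_eq_zero (hG.memLp_fluctIntegral hGc hGm hh hH).aemeasurable
    (hG.integral_fluctIntegral hGc hGm hh hH)

/-- The bound linear in `ε` serves `ε ≤ 1`, the one uniform in `ε` serves `ε ≥ 1`. -/
lemma integral_fluctIntegral_sq_le (hG : IsStationaryGaussianField P G C)
    (hGc : ∀ ω, Continuous fun x => G x ω) (hGm : ∀ x, Measurable (G x)) (hh : Measurable h)
    (hH : ∀ x, |h x| ≤ H) (hR : ∀ z, |Real.exp (C z) - 1| ≤ R)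
    (hC : Integrable fun z => Real.exp (C z) - 1) (hε : 0 < ε) :
    ∫ ω, fluctIntegral G C ε h ω ^ 2 ∂P ≤ Real.exp (C 0) * R * H ^ 2 ∧
    ∫ ω, fluctIntegral G C ε h ω ^ 2 ∂P ≤
      Real.exp (C 0) * (∫ z, |Real.exp (C z) - 1|) * H ^ 2 * ε := by
  have hprob : IsProbabilityMeasure unitVolume := ⟨by simp [unitVolume]⟩
  have hH0 : 0 ≤ H := (abs_nonneg _).trans (hH 0)
  have hCm := hG.measurable_cov hGc hGm
  obtain ⟨hi, hle⟩ := integrable_and_integral_prod_comp_sub_div_le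
    (r := fun z => |Real.exp (C z) - 1|) (by fun_prop) (fun _ => abs_nonneg _) hR hC.abs hε
  have hmain : ∫ p : ℝ × ℝ, h p.1 * h p.2 * (Real.exp (C ((p.1 - p.2) / ε)) - 1)
      ∂(unitVolume.prod unitVolume) ≤
      H ^ 2 * ∫ p : ℝ × ℝ, |Real.exp (C ((p.1 - p.2) / ε)) - 1|
        ∂(unitVolume.prod unitVolume) := by
    rw [← integral_const_mul]
    refine (Real.le_norm_self _).trans (norm_integral_le_of_norm_le (hi.const_mul _)
      (Eventually.of_forall fun p => ?_))
    rw [norm_mul, norm_mul, sq]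
    exact mul_le_mul_of_nonneg_right (mul_le_mul (hH _) (hH _) (abs_nonneg _) hH0) (abs_nonneg _)
  have hRle : ∫ p : ℝ × ℝ, |Real.exp (C ((p.1 - p.2) / ε)) - 1|
      ∂(unitVolume.prod unitVolume) ≤ R := by
    calc _ ≤ ∫ _, R ∂(unitVolume.prod unitVolume) :=
          integral_mono hi (integrable_const _) fun p => hR _
      _ = R := by simp
  have he := Real.exp_pos (C 0)
  rw [hG.integral_fluctIntegral_sq hGc hGm hh hH]
  constructor
  · calc _ ≤ Real.exp (C 0) * (H ^ 2 * R) := mul_le_mul_of_nonneg_left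
          (hmain.trans (mul_le_mul_of_nonneg_left hRle (sq_nonneg _))) he.le
      _ = _ := by ring
  · calc _ ≤ Real.exp (C 0) * (H ^ 2 * (ε * ∫ z, |Real.exp (C z) - 1|)) :=
          mul_le_mul_of_nonneg_left
            (hmain.trans (mul_le_mul_of_nonneg_left hle (sq_nonneg _))) he.le
      _ = _ := by ring

end IsStationaryGaussianField

end LimitingVariance

/-! ### Control of the quadratic remainder. -/

section VarianceExpansion

open Filter Topology

variable {Ω : Type*} [MeasurableSpace Ω] {P : Measure Ω} {G : ℝ → Ω → ℝ} {C : ℝ → ℝ}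
  {A b ε H R : ℝ} {f g h : ℝ → ℝ}

/-- Nonnegativity of the variances of `t X ± Y` gives Young's inequality for the covariance, with a
weight `t` to be optimized later. -/
lemma abs_variance_sub_sub_variance_le [IsFiniteMeasure P] {X Y : Ω → ℝ} (hX : MemLp X 2 P)
    (hY : MemLp Y 2 P) {t : ℝ} (ht : 0 < t) :
    |Var[fun ω => X ω - Y ω; P] - Var[X; P]| ≤ t * Var[X; P] + (t⁻¹ + 1) * Var[Y; P] := by
  have h1 := variance_nonneg (fun ω => t * X ω - Y ω) P
  have h2 := variance_nonneg (fun ω => t * X ω + Y ω) P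
  rw [variance_fun_sub (hX.const_mul t) hY, variance_const_mul, covariance_const_mul_left] at h1
  rw [variance_fun_add (hX.const_mul t) hY, variance_const_mul, covariance_const_mul_left] at h2
  rw [variance_fun_sub hX hY]
  have hY0 := variance_nonneg Y P
  have h3 : t * (2 * cov[X, Y; P]) ≤ t * (t * Var[X; P] + t⁻¹ * Var[Y; P]) := by
    rw [mul_add, mul_inv_cancel_left₀ ht.ne']; linarith
  have h4 : t * (-(2 * cov[X, Y; P])) ≤ t * (t * Var[X; P] + t⁻¹ * Var[Y; P]) := by
    rw [mul_add, mul_inv_cancel_left₀ ht.ne']; linarith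
  have h5 := le_of_mul_le_mul_left h3 ht
  have h6 := le_of_mul_le_mul_left h4 ht
  rw [abs_le]
  constructor <;> linarith

lemma integral_mul_le_of_integral_sq_le {U V : Ω → ℝ} {p q : ℝ} (hU : MemLp U 2 P)
    (hV : MemLp V 2 P) (hU0 : ∀ ω, 0 ≤ U ω) (hV0 : ∀ ω, 0 ≤ V ω) (hp : 0 ≤ p) (hq : 0 ≤ q)
    (hUp : ∫ ω, U ω ^ 2 ∂P ≤ p ^ 2) (hVq : ∫ ω, V ω ^ 2 ∂P ≤ q ^ 2) :
    ∫ ω, U ω * V ω ∂P ≤ p * q := by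
  have h2 : ENNReal.ofReal 2 = 2 := by simp
  have h := integral_mul_le_Lp_mul_Lq_of_nonneg (μ := P) (f := U) (g := V)
    Real.HolderConjugate.two_two (Eventually.of_forall hU0) (Eventually.of_forall hV0)
    (by rwa [h2]) (by rwa [h2])
  simp only [Real.rpow_two, ← Real.sqrt_eq_rpow] at h
  refine h.trans (mul_le_mul ?_ ?_ (Real.sqrt_nonneg _) hp)
  · exact (Real.sqrt_le_sqrt hUp).trans (Real.sqrt_sq hp).le
  · exact (Real.sqrt_le_sqrt hVq).trans (Real.sqrt_sq hq).le

/-- This replaces negative moments of the random mass `s`. If `s ≥ m/2`, the denominator is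
harmless. Otherwise `|x / s| ≤ H`, and the deviation `(s - m)² ≥ m²/4` supplies the missing
smallness. -/
lemma sq_mul_div_le {s m x y : ℝ} (hs : 0 < s) (hm : 0 < m) (hx : |x| ≤ H * s) :
    (x * y / s) ^ 2 ≤ 4 / m ^ 2 * (x ^ 2 * y ^ 2 + H ^ 2 * ((s - m) ^ 2 * y ^ 2)) := by
  have hquot : (x * y / s) ^ 2 ≤ H ^ 2 * y ^ 2 := by
    have h1 : |x / s| ≤ H := by rwa [abs_div, abs_of_pos hs, div_le_iff₀ hs]
    have h2 : (x / s) ^ 2 ≤ H ^ 2 := by rw [← sq_abs]; gcongr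
    calc (x * y / s) ^ 2 = (x / s) ^ 2 * y ^ 2 := by ring
      _ ≤ _ := by gcongr
  rcases le_total (m / 2) s with h | h
  · have h1 : (s ^ 2)⁻¹ ≤ 4 / m ^ 2 := by
      rw [← inv_div]
      refine inv_anti₀ (by positivity) ?_
      nlinarith
    calc (x * y / s) ^ 2 = (s ^ 2)⁻¹ * (x ^ 2 * y ^ 2) := by rw [div_pow]; field_simp
      _ ≤ 4 / m ^ 2 * (x ^ 2 * y ^ 2) := by gcongr
      _ ≤ _ := by
          gcongr
          exact le_add_of_nonneg_right (by positivity)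
  · have h1 : 1 ≤ 4 / m ^ 2 * (s - m) ^ 2 := by
      rw [div_mul_eq_mul_div, one_le_div (by positivity)]
      nlinarith
    calc (x * y / s) ^ 2 ≤ H ^ 2 * y ^ 2 := hquot
      _ ≤ (4 / m ^ 2 * (s - m) ^ 2) * (H ^ 2 * y ^ 2) := le_mul_of_one_le_left (by positivity) h1
      _ = 4 / m ^ 2 * (H ^ 2 * ((s - m) ^ 2 * y ^ 2)) := by ring
      _ ≤ _ := by gcongr; nlinarith [mul_nonneg (sq_nonneg x) (sq_nonneg y)]

/-- The mass of `1 / a (· / ε)` on the unit interval. -/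
noncomputable def invMass {Ω : Type*} (G : ℝ → Ω → ℝ) (ε : ℝ) (ω : Ω) : ℝ :=
  ∫ x, Real.exp (-G (x / ε) ω) ∂unitVolume

/-- The quadratic correction to the linear response of the observable. -/
noncomputable def remainder {Ω : Type*} (G : ℝ → Ω → ℝ) (C : ℝ → ℝ) (ε : ℝ) (f g : ℝ → ℝ)
    (ω : Ω) : ℝ :=
  fluctIntegral G C ε f ω * fluctIntegral G C ε g ω / invMass G ε ω

lemma integrable_exp_neg_mul {Ω : Type*} {G : ℝ → Ω → ℝ} {ω : Ω}
    (hGc : Continuous fun x => G x ω) (hf : Continuous f) :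
    Integrable (fun x => Real.exp (-G (x / ε) ω) * f x) unitVolume := by
  have : Continuous fun x => Real.exp (-G (x / ε) ω) * f x :=
    ((hGc.comp (continuous_id.div_const ε)).neg.rexp).mul hf
  exact this.integrableOn_Ioc

lemma fluctIntegral_eq {Ω : Type*} {G : ℝ → Ω → ℝ} {ω : Ω}
    (hGc : Continuous fun x => G x ω) (hf : Continuous f) :
    fluctIntegral G C ε f ω = (∫ x, Real.exp (-G (x / ε) ω) * f x ∂unitVolume) -
      Real.exp (C 0 / 2) * ∫ x, f x ∂unitVolume := by
  have hfi : Integrable f unitVolume := hf.integrableOn_Ioc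
  rw [← integral_const_mul, ← integral_sub (integrable_exp_neg_mul hGc hf) (hfi.const_mul _)]
  simp only [fluctIntegral, fluct, sub_mul]

lemma invMass_pos {Ω : Type*} {G : ℝ → Ω → ℝ} {ω : Ω} (hGc : Continuous fun x => G x ω) :
    0 < invMass G ε ω := by
  have hc : Continuous fun x => Real.exp (-G (x / ε) ω) :=
    (hGc.comp (continuous_id.div_const ε)).neg.rexp
  rw [invMass, ← intervalIntegral.integral_of_le zero_le_one]
  exact intervalIntegral.intervalIntegral_pos_of_pos (hc.intervalIntegrable _ _)
    (fun x => Real.exp_pos _) zero_lt_one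

lemma invMass_sub_eq {Ω : Type*} {G : ℝ → Ω → ℝ} {ω : Ω} (hGc : Continuous fun x => G x ω) :
    invMass G ε ω - Real.exp (C 0 / 2) = fluctIntegral G C ε (fun _ => 1) ω := by
  rw [fluctIntegral_eq hGc continuous_const]
  simp [invMass]

/-- For `f` of mean zero the subtracted mean of `1/a` drops out, leaving a pathwise bound by the
mass; this is the hypothesis of `sq_mul_div_le`. -/
lemma abs_fluctIntegral_le {Ω : Type*} {G : ℝ → Ω → ℝ} {ω : Ω}
    (hGc : Continuous fun x => G x ω) (hf : Continuous f) (hf0 : ∫ x, f x ∂unitVolume = 0)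
    (hH : ∀ x, |f x| ≤ H) : |fluctIntegral G C ε f ω| ≤ H * invMass G ε ω := by
  rw [fluctIntegral_eq hGc hf, hf0, mul_zero, sub_zero, invMass, ← integral_const_mul]
  have hi : Integrable (fun x => H * Real.exp (-G (x / ε) ω)) unitVolume := by
    simpa only [mul_comm] using integrable_exp_neg_mul (ε := ε) hGc (continuous_const (y := H))
  rw [← Real.norm_eq_abs]
  refine norm_integral_le_of_norm_le hi (Eventually.of_forall fun x => ?_)
  rw [norm_mul, Real.norm_of_nonneg (Real.exp_pos _).le, mul_comm]
  exact mul_le_mul_of_nonneg_right (hH x) (Real.exp_pos _).le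

namespace IsStationaryGaussianField

variable [IsProbabilityMeasure P]

lemma measurable_invMass (hGc : ∀ ω, Continuous fun x => G x ω)
    (hGm : ∀ x, Measurable (G x)) : Measurable (invMass G ε) := by
  have h0 := measurable_uncurry_of_continuous_of_measurable hGc hGm
  have h1 : Measurable fun q : Ω × ℝ => Real.exp (-G (q.2 / ε) q.1) :=
    Real.measurable_exp.comp
      (h0.comp ((measurable_snd.div_const ε).prodMk measurable_fst)).neg
  exact (h1.stronglyMeasurable.integral_prod_right' (ν := unitVolume)).measurable

lemma memLp_remainder_and_integral_sq_le (hG : IsStationaryGaussianField P G C)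
    (hGc : ∀ ω, Continuous fun x => G x ω) (hGm : ∀ x, Measurable (G x))
    {Hf Hg D : ℝ} (hf : Continuous f) (hg : Continuous g) (hf0 : ∫ x, f x ∂unitVolume = 0)
    (hHf : ∀ x, |f x| ≤ Hf) (hHg : ∀ x, |g x| ≤ Hg) (hR : ∀ z, |Real.exp (C z) - 1| ≤ R)
    (hC : Integrable fun z => Real.exp (C z) - 1) (hε : 0 < ε)
    (hD : D = Real.exp (C 0) ^ 2 * (1 + R) ^ 4 * (7 * (∫ z, |Real.exp (C z) - 1|) ^ 2)) :
    MemLp (remainder G C ε f g) 2 P ∧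
    ∫ ω, remainder G C ε f g ω ^ 2 ∂P ≤ Real.exp (C 0) * R * (Hf * Hg) ^ 2 ∧
    ∫ ω, remainder G C ε f g ω ^ 2 ∂P ≤
      4 / Real.exp (C 0 / 2) ^ 2 * (2 * D) * (Hf * Hg) ^ 2 * ε ^ 2 := by
  have hXf := hG.memLp_fluctIntegral (ε := ε) hGc hGm hf.measurable hHf
  have hXg := hG.memLp_fluctIntegral (ε := ε) hGc hGm hg.measurable hHg
  have hHf0 : 0 ≤ Hf := (abs_nonneg _).trans (hHf 0)
  have hR0 : 0 ≤ R := (abs_nonneg _).trans (hR 0)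
  have hD0 : 0 ≤ D := by rw [hD]; positivity
  have hle : ∀ ω, |remainder G C ε f g ω| ≤ Hf * |fluctIntegral G C ε g ω| := fun ω => by
    have hs := invMass_pos (ε := ε) (hGc ω)
    have h1 := abs_fluctIntegral_le (C := C) (ε := ε) (hGc ω) hf hf0 hHf
    rw [remainder, abs_div, abs_mul, abs_of_pos hs, div_le_iff₀ hs]
    calc _ ≤ Hf * invMass G ε ω * |fluctIntegral G C ε g ω| := by gcongr
      _ = _ := by ring
  have hmeas : AEStronglyMeasurable (remainder G C ε f g) P :=
    ((hXf.aemeasurable.mul hXg.aemeasurable).div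
      (measurable_invMass hGc hGm).aemeasurable).aestronglyMeasurable
  have hmem : MemLp (remainder G C ε f g) 2 P :=
    (hXg.const_mul Hf).mono hmeas (Eventually.of_forall fun ω => by
      rw [norm_mul, Real.norm_of_nonneg hHf0]; exact hle ω)
  refine ⟨hmem, ?_, ?_⟩
  · calc ∫ ω, remainder G C ε f g ω ^ 2 ∂P
        ≤ ∫ ω, Hf ^ 2 * fluctIntegral G C ε g ω ^ 2 ∂P := by
          refine integral_mono hmem.integrable_sq (hXg.integrable_sq.const_mul _) fun ω => ?_
          simp only
          rw [← sq_abs, ← sq_abs (fluctIntegral G C ε g ω), ← mul_pow]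
          exact pow_le_pow_left₀ (abs_nonneg _) (hle ω) 2
      _ ≤ Hf ^ 2 * (Real.exp (C 0) * R * Hg ^ 2) := by
          rw [integral_const_mul]
          exact mul_le_mul_of_nonneg_left
            (hG.integral_fluctIntegral_sq_le hGc hGm hg.measurable hHg hR hC hε).1 (sq_nonneg _)
      _ = _ := by ring
  · have h4 : ∀ {k : ℝ → ℝ} {Hk : ℝ}, Continuous k → (∀ x, |k x| ≤ Hk) →
        MemLp (fun ω => fluctIntegral G C ε k ω ^ 2) 2 P ∧
        ∫ ω, (fluctIntegral G C ε k ω ^ 2) ^ 2 ∂P ≤ (√D * Hk ^ 2 * ε) ^ 2 := by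
      intro k Hk hk hHk
      obtain ⟨h1, h2⟩ := hG.memLp_fluctIntegral_sq_and_integral_le hGc hGm hk.measurable hHk hR
        hC hε
      refine ⟨h1, h2.trans (le_of_eq ?_)⟩
      rw [← hD, mul_pow, mul_pow, Real.sq_sqrt hD0]
      ring
    obtain ⟨hf2, hf4⟩ := h4 hf hHf
    obtain ⟨hg2, hg4⟩ := h4 hg hHg
    -- The deviation of the mass from its mean is the fluctuation integral of the constant `1`, so
    -- it has the same fourth-moment bound. This second contribution explains the factor `2 * D`.
    obtain ⟨h12, h14⟩ := h4 (continuous_const (y := (1 : ℝ))) (Hk := 1) (by simp)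
    have hfg := integral_mul_le_of_integral_sq_le hf2 hg2 (fun _ => sq_nonneg _)
      (fun _ => sq_nonneg _) (by positivity) (by positivity) hf4 hg4
    have h1g := integral_mul_le_of_integral_sq_le h12 hg2 (fun _ => sq_nonneg _)
      (fun _ => sq_nonneg _) (by positivity) (by positivity) h14 hg4
    have ifg := hf2.integrable_mul hg2
    have i1g := h12.integrable_mul hg2
    calc ∫ ω, remainder G C ε f g ω ^ 2 ∂P
        ≤ ∫ ω, 4 / Real.exp (C 0 / 2) ^ 2 * (fluctIntegral G C ε f ω ^ 2 *
            fluctIntegral G C ε g ω ^ 2 + Hf ^ 2 * (fluctIntegral G C ε (fun _ => 1) ω ^ 2 *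
            fluctIntegral G C ε g ω ^ 2)) ∂P := by
          refine integral_mono hmem.integrable_sq ((ifg.add (i1g.const_mul _)).const_mul _)
            fun ω => ?_
          simp only
          rw [← invMass_sub_eq (hGc ω)]
          exact sq_mul_div_le (invMass_pos (hGc ω)) (Real.exp_pos _)
            (abs_fluctIntegral_le (hGc ω) hf hf0 hHf)
      _ = 4 / Real.exp (C 0 / 2) ^ 2 * ((∫ ω, fluctIntegral G C ε f ω ^ 2 *
            fluctIntegral G C ε g ω ^ 2 ∂P) + Hf ^ 2 * ∫ ω,
            fluctIntegral G C ε (fun _ => 1) ω ^ 2 * fluctIntegral G C ε g ω ^ 2 ∂P) := by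
          rw [integral_const_mul, ← integral_const_mul (Hf ^ 2)]
          congr 1
          exact integral_add ifg (i1g.const_mul _)
      _ ≤ 4 / Real.exp (C 0 / 2) ^ 2 * (√D * Hf ^ 2 * ε * (√D * Hg ^ 2 * ε) +
            Hf ^ 2 * (√D * 1 ^ 2 * ε * (√D * Hg ^ 2 * ε))) := by
          gcongr
      _ = 4 / Real.exp (C 0 / 2) ^ 2 * (2 * √D ^ 2) * (Hf * Hg) ^ 2 * ε ^ 2 := by ring
      _ = _ := by rw [Real.sq_sqrt hD0]

end IsStationaryGaussianField

end VarianceExpansion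

/-! ### Quantitative convergence of the variance, and centering of the data. -/

section VarianceConvergence

open Filter Topology

variable {Ω : Type*} [MeasurableSpace Ω] {P : Measure Ω} {G : ℝ → Ω → ℝ} {C : ℝ → ℝ}
  {A b : ℝ}

lemma IsStationaryGaussianField.exists_variance_estimate [IsProbabilityMeasure P]
    (hG : IsStationaryGaussianField P G C)
    (hGc : ∀ ω, Continuous fun x => G x ω) (hGm : ∀ x, Measurable (G x))
    (hb : 1 < b) (hb' : b ≤ 3 / 2) (hdecay : ∀ z, |C z| ≤ A * (1 + |z|) ^ (-b)) :
    ∃ K, ∀ (f g : ℝ → ℝ) (Hf Hg ε : ℝ), Continuous f → Continuous g →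
      ∫ x, f x ∂unitVolume = 0 → (∀ x, |f x| ≤ Hf) → (∀ x, |g x| ≤ Hg) →
      (∀ x ∈ Icc (0 : ℝ) 1, ∀ y ∈ Icc (0 : ℝ) 1, |f x - f y| ≤ Hf * |x - y|) →
      (∀ x ∈ Icc (0 : ℝ) 1, ∀ y ∈ Icc (0 : ℝ) 1, |g x - g y| ≤ Hg * |x - y|) → 0 < ε →
      MemLp (fun ω => fluctIntegral G C ε (fun x => f x * g x) ω - remainder G C ε f g ω) 2 P ∧
      |ε⁻¹ * Var[fun ω => fluctIntegral G C ε (fun x => f x * g x) ω -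
          remainder G C ε f g ω; P] -
        Real.exp (C 0) * (∫ z, (Real.exp (C z) - 1)) * ∫ x, (f x * g x) ^ 2 ∂unitVolume| ≤
        K * (Hf * Hg) ^ 2 * ε ^ (b - 1) := by
  have hCm := hG.measurable_cov hGc hGm
  have hA := decay_const_nonneg hdecay
  have hρd := decay_exp_sub_one (by linarith) hdecay
  have hρi : Integrable fun z => Real.exp (C z) - 1 := integrable_of_decay (by fun_prop) hb hρd
  set B := A * Real.exp A with hB
  have hB0 : 0 ≤ B := by positivity
  have hρB : ∀ z, |Real.exp (C z) - 1| ≤ B :=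
    decay_le_const (C := fun z => Real.exp (C z) - 1) (by linarith) hρd
  obtain ⟨K₀, hK₀, hK⟩ := exists_kernel_concentration hb (by linarith)
  set e := Real.exp (C 0) with he
  have he0 : 0 < e := Real.exp_pos _
  set L := ∫ z, |Real.exp (C z) - 1| with hL
  have hL0 : 0 ≤ L := integral_nonneg fun _ => abs_nonneg _
  set D := e ^ 2 * (1 + B) ^ 4 * (7 * L ^ 2) with hD
  set c := 4 / Real.exp (C 0 / 2) ^ 2 * (2 * D) with hc
  have hc0 : 0 ≤ c := by positivity
  -- The first summand is the kernel error, with `4` from the Lipschitz constant `2 * S` squared; `e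
  -- * L + 2 * c` is the remainder for `ε ≤ 1`, and `3 * e * B` for `ε ≥ 1`.
  refine ⟨4 * e * K₀ * B + (e * L + 2 * c + 3 * e * B), ?_⟩
  intro f g Hf Hg ε hf hg hf0 hHf hHg hLf hLg hε
  have hHf0 : 0 ≤ Hf := (abs_nonneg _).trans (hHf 0)
  have hHg0 : 0 ≤ Hg := (abs_nonneg _).trans (hHg 0)
  set S := Hf * Hg with hS
  have hS0 : 0 ≤ S := mul_nonneg hHf0 hHg0
  set h : ℝ → ℝ := fun x => f x * g x with hh
  have hhc : Continuous h := hf.mul hg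
  have hhS : ∀ x, |h x| ≤ S := fun x => by
    simp only [hh, abs_mul]
    exact mul_le_mul (hHf x) (hHg x) (abs_nonneg _) hHf0
  have hhL : ∀ x ∈ Icc (0 : ℝ) 1, ∀ y ∈ Icc (0 : ℝ) 1, |h x - h y| ≤ 2 * S * |x - y| := by
    intro x hx y hy
    have : h x - h y = f x * (g x - g y) + (f x - f y) * g y := by simp only [hh]; ring
    rw [this]
    refine (abs_add_le _ _).trans ?_
    rw [abs_mul, abs_mul]
    have h1 : |f x| * |g x - g y| ≤ Hf * (Hg * |x - y|) :=
      mul_le_mul (hHf x) (hLg x hx y hy) (abs_nonneg _) hHf0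
    have h2 : |f x - f y| * |g y| ≤ Hf * |x - y| * Hg :=
      mul_le_mul (hLf x hx y hy) (hHg y) (abs_nonneg _) (by positivity)
    linarith
  have hX := hG.memLp_fluctIntegral (ε := ε) hGc hGm hhc.measurable hhS
  obtain ⟨hRm, hR1, hR2⟩ := hG.memLp_remainder_and_integral_sq_le hGc hGm hf hg hf0 hHf hHg hρB
    hρi hε hD
  refine ⟨hX.sub hRm, ?_⟩
  have hVX := hG.variance_fluctIntegral (ε := ε) hGc hGm hhc.measurable hhS
  obtain ⟨hX1, hX2⟩ := hG.integral_fluctIntegral_sq_le hGc hGm hhc.measurable hhS hρB hρi hε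
  have hVR : Var[remainder G C ε f g; P] ≤ ∫ ω, remainder G C ε f g ω ^ 2 ∂P :=
    variance_le_expectation_sq hRm.aestronglyMeasurable
  rw [← hVX] at hX1 hX2
  have hVR1 := hVR.trans hR1
  have hVR2 := hVR.trans hR2
  have hVR0 := variance_nonneg (remainder G C ε f g) P
  have hVX0 := variance_nonneg (fluctIntegral G C ε h) P
  have hpow : ε ^ b = ε * ε ^ (b - 1) := by
    rw [← Real.rpow_one_add' hε.le (by linarith), add_sub_cancel]
  have hpow0 : 0 < ε ^ (b - 1) := Real.rpow_pos_of_pos hε _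
  have hmain : |ε⁻¹ * Var[fluctIntegral G C ε h; P] -
      e * (∫ z, (Real.exp (C z) - 1)) * ∫ x, h x ^ 2 ∂unitVolume| ≤
      4 * e * K₀ * B * S ^ 2 * ε ^ (b - 1) := by
    have h1 := hK (fun z => Real.exp (C z) - 1) h B (2 * S) ε (by fun_prop) hhc.measurable hε hρd
      (fun x => (hhS x).trans (by linarith)) hhL
    rw [hVX, hG.integral_fluctIntegral_sq hGc hGm hhc.measurable hhS]
    have h2 : ∀ I J : ℝ, ε⁻¹ * (e * I) - e * (∫ z, (Real.exp (C z) - 1)) * J =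
        ε⁻¹ * e * (I - ε * (∫ z, (Real.exp (C z) - 1)) * J) := fun I J => by
      field_simp
    rw [h2, abs_mul, abs_of_pos (by positivity)]
    calc _ ≤ ε⁻¹ * e * (K₀ * B * (2 * S) ^ 2 * ε ^ b) :=
          mul_le_mul_of_nonneg_left h1 (by positivity)
      _ = _ := by rw [hpow]; field_simp; ring
  have hrem : ε⁻¹ * |Var[fun ω => fluctIntegral G C ε h ω - remainder G C ε f g ω; P] -
      Var[fluctIntegral G C ε h; P]| ≤ (e * L + 2 * c + 3 * e * B) * S ^ 2 * ε ^ (b - 1) := by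
    rcases le_total ε 1 with hε1 | hε1
    -- With variances of order `ε` and `ε²`, the choice `t = √ε` balances the two terms of Young's
    -- inequality at `ε ^ (3/2)`.
    · set t := √ε with ht
      have ht0 : 0 < t := Real.sqrt_pos.2 hε
      have htt : ε = t ^ 2 := (Real.sq_sqrt hε.le).symm
      have ht1 : t ≤ 1 := by rw [ht]; exact Real.sqrt_le_one.2 hε1
      -- This is where `b ≤ 3/2` is needed.
      have hte : t ≤ ε ^ (b - 1) := by
        rw [ht, Real.sqrt_eq_rpow]
        exact Real.rpow_le_rpow_of_exponent_ge hε hε1 (by linarith)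
      have h1 := abs_variance_sub_sub_variance_le hX hRm ht0
      have hti : 1 ≤ t⁻¹ := (one_le_inv₀ ht0).2 ht1
      calc _ ≤ ε⁻¹ * (t * (e * L * S ^ 2 * ε) + (t⁻¹ + t⁻¹) * (c * S ^ 2 * ε ^ 2)) := by
            refine mul_le_mul_of_nonneg_left (h1.trans ?_) (by positivity)
            gcongr
        _ = (e * L + 2 * c) * S ^ 2 * t := by rw [htt]; field_simp; ring
        _ ≤ (e * L + 2 * c + 3 * e * B) * S ^ 2 * ε ^ (b - 1) := by
            have : 0 ≤ 3 * e * B := by positivity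
            exact mul_le_mul (mul_le_mul_of_nonneg_right (by linarith) (sq_nonneg _)) hte ht0.le
              (by positivity)
    -- For `ε ≥ 1` the bounds uniform in `ε` suffice, since `ε ^ (b - 1) ≥ 1`.
    · have h1 := abs_variance_sub_sub_variance_le hX hRm one_pos
      have hp1 : 1 ≤ ε ^ (b - 1) := Real.one_le_rpow hε1 (by linarith)
      have hi1 : ε⁻¹ ≤ 1 := inv_le_one_of_one_le₀ hε1
      calc _ ≤ 1 * (1 * (e * B * S ^ 2) + (1⁻¹ + 1) * (e * B * S ^ 2)) := by
            refine mul_le_mul hi1 (h1.trans ?_) (abs_nonneg _) zero_le_one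
            gcongr
        _ = 3 * e * B * S ^ 2 * 1 := by ring
        _ ≤ (e * L + 2 * c + 3 * e * B) * S ^ 2 * ε ^ (b - 1) := by
            have : 0 ≤ e * L + 2 * c := by positivity
            exact mul_le_mul (mul_le_mul_of_nonneg_right (by linarith) (sq_nonneg _)) hp1
              zero_le_one (by positivity)
  have hrem' : |ε⁻¹ * Var[fun ω => fluctIntegral G C ε h ω - remainder G C ε f g ω; P] -
      ε⁻¹ * Var[fluctIntegral G C ε h; P]| ≤
      (e * L + 2 * c + 3 * e * B) * S ^ 2 * ε ^ (b - 1) := by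
    rwa [← mul_sub, abs_mul, abs_of_pos (inv_pos.2 hε)]
  refine (abs_sub_le _ (ε⁻¹ * Var[fluctIntegral G C ε h; P]) _).trans
    ((add_le_add hrem' hmain).trans (le_of_eq ?_))
  ring

lemma abs_le_normC1 {f : ℝ → ℝ} (hf : ContDiffOn ℝ 1 f (Icc 0 1)) {x : ℝ}
    (hx : x ∈ Icc (0 : ℝ) 1) :
    |f x| ≤ normC1 f ∧ |derivWithin f (Icc 0 1) x| ≤ normC1 f := by
  have hbdd : ∀ {k : ℝ → ℝ}, ContinuousOn k (Icc 0 1) →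
      BddAbove (range fun x : Icc (0 : ℝ) 1 => |k x|) := fun {k} hk => by
    have := (isCompact_Icc.image_of_continuousOn hk.abs).bddAbove
    rwa [image_eq_range] at this
  have h1 := le_ciSup (hbdd hf.continuousOn) ⟨x, hx⟩
  have h2 := le_ciSup (hbdd (hf.continuousOn_derivWithin (uniqueDiffOn_Icc zero_lt_one) le_rfl))
    ⟨x, hx⟩
  simp only at h1 h2
  have h3 := (abs_nonneg _).trans h1
  have h4 := (abs_nonneg _).trans h2
  unfold normC1
  exact ⟨by linarith, by linarith⟩

lemma abs_sub_le_normC1_mul {f : ℝ → ℝ} (hf : ContDiffOn ℝ 1 f (Icc 0 1)) {x y : ℝ}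
    (hx : x ∈ Icc (0 : ℝ) 1) (hy : y ∈ Icc (0 : ℝ) 1) :
    |f x - f y| ≤ normC1 f * |x - y| :=
  (convex_Icc (0 : ℝ) 1).norm_image_sub_le_of_norm_derivWithin_le
    (hf.differentiableOn one_ne_zero) (fun _ hz => (abs_le_normC1 hf hz).2) hy hx

/-- The centered version of `f` on the unit interval, extended continuously to the line. -/
noncomputable def centered (f : ℝ → ℝ) : ℝ → ℝ :=
  IccExtend zero_le_one ((Icc (0 : ℝ) 1).domRestrict fun x => f x - ∫ y in (0 : ℝ)..1, f y)

lemma centered_of_mem (f : ℝ → ℝ) {x : ℝ} (hx : x ∈ Icc (0 : ℝ) 1) :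
    centered f x = f x - ∫ y in (0 : ℝ)..1, f y := by
  rw [centered, IccExtend_of_mem _ _ hx, domRestrict_apply]

lemma continuous_centered {f : ℝ → ℝ} (hf : ContinuousOn f (Icc 0 1)) : Continuous (centered f) :=
  (hf.sub continuousOn_const).domRestrict.Icc_extend'

lemma integral_unitVolume_congr {k l : ℝ → ℝ} (h : ∀ x ∈ Icc (0 : ℝ) 1, k x = l x) :
    ∫ x, k x ∂unitVolume = ∫ x in (0 : ℝ)..1, l x := by
  rw [intervalIntegral.integral_of_le zero_le_one]
  exact setIntegral_congr_fun measurableSet_Ioc fun x hx => h x (Ioc_subset_Icc_self hx)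

lemma integral_centered {f : ℝ → ℝ} (hf : ContinuousOn f (Icc 0 1)) :
    ∫ x, centered f x ∂unitVolume = 0 := by
  rw [integral_unitVolume_congr fun x hx => centered_of_mem f hx, intervalIntegral.integral_sub
    (hf.intervalIntegrable_of_Icc zero_le_one) (by simp)]
  simp

lemma abs_centered_le {f : ℝ → ℝ} (hf : ContDiffOn ℝ 1 f (Icc 0 1)) (x : ℝ) :
    |centered f x| ≤ 2 * normC1 f := by
  have hint : |∫ y in (0 : ℝ)..1, f y| ≤ normC1 f := by
    have := intervalIntegral.norm_integral_le_of_norm_le_const (a := (0 : ℝ)) (b := 1) (f := f)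
      (C := normC1 f) fun y hy => by
        rw [uIoc_of_le zero_le_one] at hy
        exact (abs_le_normC1 hf (Ioc_subset_Icc_self hy)).1
    simpa using this
  have hp : ∀ y ∈ Icc (0 : ℝ) 1, |f y - ∫ t in (0 : ℝ)..1, f t| ≤ 2 * normC1 f := fun y hy =>
    (abs_sub _ _).trans (by linarith [(abs_le_normC1 hf hy).1])
  exact hp _ (projIcc (0 : ℝ) 1 zero_le_one x).2

lemma abs_centered_sub_le {f : ℝ → ℝ} (hf : ContDiffOn ℝ 1 f (Icc 0 1)) {x y : ℝ}
    (hx : x ∈ Icc (0 : ℝ) 1) (hy : y ∈ Icc (0 : ℝ) 1) :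
    |centered f x - centered f y| ≤ 2 * normC1 f * |x - y| := by
  rw [centered_of_mem f hx, centered_of_mem f hy, sub_sub_sub_cancel_right]
  have h := abs_sub_le_normC1_mul hf hx hy
  have h0 := (abs_nonneg _).trans (abs_le_normC1 hf hx).1
  nlinarith [abs_nonneg (x - y)]

/-- An exact identity: centering removes the mean of `1/a` from `∫ f / a` and `∫ g / a`, so the
correction to the linear term is purely quadratic in the fluctuation. -/
lemma IsSolution.observable_eq_fluctIntegral {Ω : Type*} {G : ℝ → Ω → ℝ} {ω : Ω} {ε : ℝ}
    {f g u : ℝ → ℝ} (C : ℝ → ℝ) (hGc : Continuous fun x => G x ω)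
    (hf : ContDiffOn ℝ 1 f (Icc 0 1)) (hg : ContDiffOn ℝ 1 g (Icc 0 1))
    (hu : IsSolution (fun x => coeff G x ω) ε f u) :
    observable u g = Real.exp (C 0 / 2) * (∫ x, centered f x * centered g x ∂unitVolume) +
      (fluctIntegral G C ε (fun x => centered f x * centered g x) ω -
        remainder G C ε (centered f) (centered g) ω) := by
  have ha : Continuous fun x => coeff G x ω := hGc.rexp
  have hpos : ∀ x, 0 < coeff G x ω := fun x => Real.exp_pos _
  have hb := continuous_inv_comp_div (ε := ε) ha hpos
  have hinv : ∀ x, (coeff G (x / ε) ω)⁻¹ = Real.exp (-G (x / ε) ω) := fun x => by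
    rw [coeff, Real.exp_neg]
  have hFc := continuous_centered hf.continuousOn
  have hgc := continuous_centered hg.continuousOn
  rw [hu.observable_eq ha hpos hf hg, ← weighted_covariance_sub_const hb.continuousOn
    hf.continuousOn hg.continuousOn (integral_inv_pos ha hpos).ne' (∫ y in (0 : ℝ)..1, f y)
    (∫ y in (0 : ℝ)..1, g y), remainder,
    fluctIntegral_eq (f := fun x => centered f x * centered g x) hGc (hFc.mul hgc),
    fluctIntegral_eq hGc hFc, fluctIntegral_eq hGc hgc, integral_centered hf.continuousOn,
    integral_centered hg.continuousOn, invMass, mul_zero, sub_zero, sub_zero]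
  simp only [hinv]
  rw [← integral_unitVolume_congr (k := fun x => Real.exp (-G (x / ε) ω) *
      (centered f x * centered g x)) fun x hx => by rw [centered_of_mem f hx, centered_of_mem g hx],
    ← integral_unitVolume_congr (k := fun x => Real.exp (-G (x / ε) ω) * centered f x)
      fun x hx => by rw [centered_of_mem f hx],
    ← integral_unitVolume_congr (k := fun x => Real.exp (-G (x / ε) ω) * centered g x)
      fun x hx => by rw [centered_of_mem g hx],
    ← integral_unitVolume_congr (k := fun x => Real.exp (-G (x / ε) ω)) fun x _ => rfl]
  ring

end VarianceConvergence

end LogNormalHomogenization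

theorem mainTheorem3 {Ω : Type*} [MeasurableSpace Ω] (P : Measure Ω) [IsProbabilityMeasure P]
    (G : ℝ → Ω → ℝ) (C : ℝ → ℝ) (hG : IsStationaryGaussianField P G C)
    (hcont : ∀ᵐ ω ∂P, Continuous fun x => G x ω)
    (β : ℝ) (hβ : 1 < β) (hdecay : ∃ A : ℝ, ∀ x, |C x| ≤ A * (1 + |x|) ^ (-β))
    (hne : ¬ ∀ᵐ ω ∂P, ∀ x, G x ω = 0) :
    -- almost sure well-posedness of the boundary value problem
    (∀ᵐ ω ∂P, ∀ ε : ℝ, 0 < ε → ∀ f : ℝ → ℝ, ContDiffOn ℝ 1 f (Icc 0 1) →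
      (∃ u, IsSolution (fun x => coeff G x ω) ε f u) ∧
      ∀ u₁ u₂, IsSolution (fun x => coeff G x ω) ε f u₁ →
        IsSolution (fun x => coeff G x ω) ε f u₂ → EqOn u₁ u₂ (Icc 0 1)) ∧
    -- the constant `𝒬`
    Integrable (covInv P G) ∧
    Integrable (fun x => Real.exp (C x) - 1) ∧
    limQ P G = Real.exp (C 0) * ∫ x, (Real.exp (C x) - 1) ∧
    0 < limQ P G ∧
    -- convergence of the rescaled variance
    ∃ K : ℝ, ∀ f g : ℝ → ℝ, ContDiffOn ℝ 1 f (Icc 0 1) → ContDiffOn ℝ 1 g (Icc 0 1) →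
      ∀ ε : ℝ, 0 < ε → ∀ u v : Ω → ℝ → ℝ,
        (∀ᵐ ω ∂P, IsSolution (fun x => coeff G x ω) ε f (u ω)) →
        (∀ᵐ ω ∂P, IsSolution (fun x => coeff G x ω) ε g (v ω)) →
        (∀ᵐ ω ∂P, observable (u ω) g = observable (v ω) f) ∧
        MemLp (fun ω => observable (u ω) g) 2 P ∧
        |sigmaEps P ε (fun ω => observable (u ω) g) ^ 2 - sigmaSq P G f g| ≤
          K * normC1 f ^ 2 * normC1 g ^ 2 * ε ^ min (1 / 2) (β - 1) := by
  obtain ⟨A, hA⟩ := hdecay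
  obtain ⟨G', hGc, hGm, hGG'⟩ :=
    exists_continuous_measurable_modification hG.gaussian.aemeasurable hcont
  have hG' : IsStationaryGaussianField P G' C :=
    hG.congr fun x => hGG'.mono fun ω hω => (hω x).symm
  -- Lowering the decay exponent costs nothing in the final rate: `b - 1` is exactly `min (1/2) (β -
  -- 1)`, and `b < 2` as the kernel estimate requires.
  set b := min β (3 / 2) with hb
  have hb1 : 1 < b := lt_min hβ (by norm_num)
  have hb2 : b ≤ 3 / 2 := min_le_right _ _
  have hdec := decay_mono (min_le_left β (3 / 2)) hA
  have hCm := hG'.measurable_cov hGc hGm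
  have hρi : Integrable fun z => Real.exp (C z) - 1 := integrable_of_decay (by fun_prop) hb1
    (decay_exp_sub_one (by linarith) hdec)
  have hexp : min (1 / 2) (β - 1) = b - 1 := by
    rw [hb, ← min_sub_sub_right, min_comm]; norm_num
  have hposc : ∀ ω x, 0 < coeff G x ω := fun ω x => Real.exp_pos _
  refine ⟨?_, ?_, hρi, hG.limQ_eq, ?_, ?_⟩
  · filter_upwards [hcont] with ω hω ε _ f hf
    have ha : Continuous fun x => coeff G x ω := hω.rexp
    exact ⟨exists_isSolution ha (hposc ω) hf,
      fun u₁ u₂ h₁ h₂ => h₁.eqOn ha (hposc ω) hf h₂⟩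
  · rw [show covInv P G = _ from funext hG.covInv_eq]
    exact hρi.const_mul _
  · rw [hG.limQ_eq]
    exact mul_pos (Real.exp_pos _) (hG'.integral_exp_cov_sub_one_pos hGc hGm hb1 (by linarith) hdec
      (hG.cov_zero_pos hcont hne))
  · obtain ⟨K, hK⟩ := hG'.exists_variance_estimate hGc hGm hb1 hb2 hdec
    -- Centering doubles each of the two norms, and their product enters squared: `(2 * 2)² = 16`.
    refine ⟨16 * K, fun f g hf hg ε hε u v hu hv => ?_⟩
    have hobs : (fun ω => observable (u ω) g) =ᵐ[P] fun ω =>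
        Real.exp (C 0 / 2) * (∫ x, centered f x * centered g x ∂unitVolume) +
        (fluctIntegral G' C ε (fun x => centered f x * centered g x) ω -
          remainder G' C ε (centered f) (centered g) ω) := by
      filter_upwards [hu, hGG'] with ω hω hGω
      refine IsSolution.observable_eq_fluctIntegral C (hGc ω) hf hg ?_
      simpa only [coeff, hGω] using hω
    obtain ⟨hmem, hest⟩ := hK (centered f) (centered g) (2 * normC1 f) (2 * normC1 g) ε
      (continuous_centered hf.continuousOn) (continuous_centered hg.continuousOn)
      (integral_centered hf.continuousOn) (abs_centered_le hf) (abs_centered_le hg)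
      (fun x hx y hy => abs_centered_sub_le hf hx hy)
      (fun x hx y hy => abs_centered_sub_le hg hx hy) hε
    refine ⟨?_, ?_, ?_⟩
    · filter_upwards [hu, hv, hcont] with ω hu hv hω
      have ha : Continuous fun x => coeff G x ω := hω.rexp
      rw [hu.observable_eq ha (hposc ω) hf hg, hv.observable_eq ha (hposc ω) hg hf]
      simp only [mul_comm (g _) (f _)]
      ring
    · rw [memLp_congr_ae hobs]
      exact MemLp.add (memLp_const (Real.exp (C 0 / 2) *
        (∫ x, centered f x * centered g x ∂unitVolume))) hmem
    · have hsq : ∫ x, (centered f x * centered g x) ^ 2 ∂unitVolume = ∫ x in (0 : ℝ)..1,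
          (f x - ∫ y in (0 : ℝ)..1, f y) ^ 2 * (g x - ∫ y in (0 : ℝ)..1, g y) ^ 2 :=
        integral_unitVolume_congr fun x hx => by
          rw [centered_of_mem f hx, centered_of_mem g hx, mul_pow]
      rw [sigmaEps, Real.sq_sqrt (mul_nonneg (inv_nonneg.2 hε.le) (variance_nonneg _ _)),
        variance_congr hobs, variance_const_add hmem.aestronglyMeasurable, sigmaSq, hG.limQ_eq,
        ← hsq, hexp]
      refine hest.trans (le_of_eq ?_)
      ring
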